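/- Let $\Bbbk$ be a field and $H=\Bbbk[\partial]$. Identities below are required for homogeneous elements. **GD-superalgebras.** A Gel'fand–Dorfman (GD-) superalgebra is a $\mathbb Z_2$-graded space $V=V_0\oplus V_1$ over $\Bbbk$ with even bilinear operations $\circ$ and $[\cdot,\cdot]$ such that $\circ$ is a Novikov superproduct, $$(a\circ b)\circ c-a\circ(b\circ c)=(-1)^{|a||b|}\big((b\circ a)\circ c-b\circ(a\circ c)\big),\qquad (a\circ b)\circ c=(-1)^{|b||c|}(a\circ c)\circ b,$$ $[\cdot,\cdot]$ is a Lie superbracket (super skew-symmetry and super Jacobi identity), and $$b\circ[a,c]=(-1)^{|a||b|}\big([a,b\circ c]-[a,b]\circ c\big)-(-1)^{|a||c|+|b||c|}\big([c,b\circ a]-[c,b]\circ a\big).$$ A differential Poisson superalgebra is an associative supercommutative superalgebra $P$ over $\Bbbk$ with a Lie superbracket $\{\cdot,\cdot\}$ satisfying $\{a,bc\}=\{a,b\}c+(-1)^{|a||b|}b\{a,c\}$, and an even linear map $d$ that is a derivation of both operations. A GD-superalgebra $V$ is *special* if there are a differential Poisson superalgebra $P$ and an injective even linear map $\tau:V\to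 P$ with $\tau(a\circ b)=\tau(a)\,d(\tau(b))$ and $\tau([a,b])=\{\tau(a),\tau(b)\}$ for all $a,b\in V$. **Lie conformal superalgebras.** A Lie conformal superalgebra is a $\mathbb Z_2$-graded $H$-module $L$ with an even bilinear bracket $[\cdot{}_\lambda\cdot]:L\times L\to L[\lambda]$ such that $[\partial a{}_\lambda b]=-\lambda[a{}_\lambda b]$, $[a{}_\lambda\partial b]=(\partial+\lambda)[a{}_\lambda b]$, $[a{}_\lambda b]=-(-1)^{|a||b|}[b{}_{-\partial-\lambda}a]$, and $[a{}_\lambda[b{}_\mu c]]-(-1)^{|a||b|}[b{}_\mu[a{}_\lambda c]]=[[a{}_\lambda b]{}_{\lambda+\mu}c]$. A conformal representation of $L$ on a $\mathbb Z_2$-graded $H$-module $M$ is an even bilinear map $\rho_\lambda:L\times M\to M[\lambda]$ such that $\rho_\lambda(\partial a,x)=-\lambda\rho_\lambda(a,x)$, $\rho_\lambda(a,\partial x)=(\partial+\lambda)\rho_\lambda(a,x)$, and $\rho_\lambda(a,\rho_\mu(b,x))-(-1)^{|a||b|}\rho_\mu(b,\rho_\lambda(a,x))=\rho_{\lambda+\mu}([a{}_\lambda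 b],x)$. It is *finite* if $M$ is a finitely generated $H$-module, and *faithful* if $\rho_\lambda(a,\cdot)=0$ implies $a=0$ for $a\in L$. For a GD-superalgebra $V$, the *quadratic Lie conformal superalgebra* $L(V)$ is the $H$-module $H\otimes V$ with the bracket determined by $$[a{}_\lambda b]=[a,b]+(-1)^{|a||b|}\partial(b\circ a)+\lambda\big(a\circ b+(-1)^{|a||b|}b\circ a\big),\qquad a,b\in V_0\cup V_1.$$ **Theorem.** If $V$ is a finite-dimensional special GD-superalgebra over $\Bbbk$, then the Lie conformal superalgebra $L(V)$ has a finite faithful conformal representation. -/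

import Mathlib

open Polynomial TensorProduct

universe u v w

set_option linter.unusedSectionVars false
set_option linter.unusedSimpArgs false

/-! ## Superspaces -/

/-- The Koszul sign `(-1)^{|a||b|}` for elements of parities `i` and `j`. -/
def superSign (i j : ZMod 2) : ℤ := if i = 1 ∧ j = 1 then -1 else 1

theorem superSign_comm (i j : ZMod 2) : superSign i j = superSign j i := by
  simp only [superSign, and_comm]

theorem superSign_add_right (i j k : ZMod 2) :
    superSign i (j + k) = superSign i j * superSign i k := by
  revert i j k; decide

theorem superSign_add_left (i j k : ZMod 2) :
    superSign (i + j) k = superSign i k * superSign j k := by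
  revert i j k; decide

theorem superSign_eq (i j : ZMod 2) : superSign i j = 1 ∨ superSign i j = -1 := by
  revert i j; decide

/-- A `ℤ/2ℤ`-grading `M = M_0 ⊕ M_1` of an `R`-module by submodules. -/
structure SuperGrading (R : Type*) (M : Type*) [CommRing R] [AddCommGroup M] [Module R M] where
  part : ZMod 2 → Submodule R M
  isInternal : DirectSum.IsInternal part

namespace SuperGrading

variable {R M : Type*} [CommRing R] [AddCommGroup M] [Module R M]

/-- The projection `M → M_i ⊆ M` onto the homogeneous component of parity `i`. -/
noncomputable def proj (g : SuperGrading R M) (i : ZMod 2) : M →ₗ[R] M :=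
  (g.part i).subtype ∘ₗ DirectSum.component R (ZMod 2) (fun i => g.part i) i ∘ₗ
    (LinearEquiv.ofBijective (DirectSum.coeLinearMap g.part) g.isInternal).symm.toLinearMap

theorem proj_of_mem (g : SuperGrading R M) {i : ZMod 2} (j : ZMod 2) {a : M}
    (ha : a ∈ g.part i) : g.proj j a = if j = i then a else 0 := by
  unfold proj
  change ((((LinearEquiv.ofBijective (DirectSum.coeLinearMap g.part) g.isInternal).symm a) j :
    g.part j) : M) = _
  by_cases h : j = i
  · subst h
    simpa using congrArg Subtype.val (g.isInternal.ofBijective_coeLinearMap_same ⟨a, ha⟩)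
  · rw [g.isInternal.ofBijective_coeLinearMap_of_mem_ne (Ne.symm h) ha]
    simp [h]

end SuperGrading

theorem isInternal_baseChange {𝕜 V : Type*} [Field 𝕜] [AddCommGroup V] [Module 𝕜 V]
    {ι : Type*} [DecidableEq ι] (R : Type*) [CommRing R] [Algebra 𝕜 R] (p : ι → Submodule 𝕜 V)
    (q : ι → V →ₗ[𝕜] V) (hq : ∀ i j, ∀ a ∈ p i, q j a = if j = i then a else 0)
    (hp : ⨆ i, p i = ⊤) : DirectSum.IsInternal fun i => (p i).baseChange R := by
  apply DirectSum.isInternal_submodule_of_iSupIndep_of_iSup_eq_top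
  · have h0 : ∀ i, ∀ x ∈ (p i).baseChange R, ∀ j, (q j).baseChange R x = if j = i then x else 0 := by
      intro i x hx j
      rw [Submodule.baseChange_eq_span] at hx
      induction hx using Submodule.span_induction with
      | mem x hx =>
        obtain ⟨u, hu, rfl⟩ := hx
        simp only [TensorProduct.mk_apply, LinearMap.baseChange_tmul, hq i j u hu]
        split_ifs <;> simp
      | zero => simp
      | add x y _ _ hx hy => rw [map_add, hx, hy]; split_ifs <;> simp
      | smul f x _ hx => rw [map_smul, hx]; split_ifs <;> simp
    intro i
    rw [Submodule.disjoint_def]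
    intro x hx hx'
    have h1 := h0 i x hx i
    rw [if_pos rfl] at h1
    have h2 : (⨆ j, ⨆ (_ : j ≠ i), (p j).baseChange R) ≤ LinearMap.ker ((q i).baseChange R) := by
      refine iSup₂_le fun j hj y hy => ?_
      rw [LinearMap.mem_ker, h0 j y hy i, if_neg hj.symm]
    rw [← h1]
    exact h2 hx'
  · rw [eq_top_iff]
    have h3 : (⊤ : Submodule 𝕜 V) ≤ ((⨆ i, (p i).baseChange R).restrictScalars 𝕜).comap
        (TensorProduct.mk 𝕜 R V 1) := by
      rw [← hp]
      refine iSup_le fun i v hv => ?_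
      exact (le_iSup (fun i => (p i).baseChange R) i) (Submodule.tmul_mem_baseChange_of_mem 1 hv)
    rintro x -
    induction x with
    | zero => exact Submodule.zero_mem _
    | add x y hx hy => exact Submodule.add_mem _ hx hy
    | tmul r v =>
      have h4 : (1 : R) ⊗ₜ[𝕜] v ∈ ⨆ i, (p i).baseChange R := h3 (Submodule.mem_top (x := v))
      have h5 := Submodule.smul_mem _ r h4
      rwa [TensorProduct.smul_tmul', smul_eq_mul, mul_one] at h5

/-- The grading of `R ⊗ V` induced by a grading of `V`. -/
def SuperGrading.baseChange {𝕜 V : Type*} [Field 𝕜] [AddCommGroup V] [Module 𝕜 V]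
    (g : SuperGrading 𝕜 V) (R : Type*) [CommRing R] [Algebra 𝕜 R] : SuperGrading R (R ⊗[𝕜] V) where
  part := fun i => (g.part i).baseChange R
  isInternal := isInternal_baseChange R g.part g.proj (fun _ j _ ha => g.proj_of_mem j ha)
    g.isInternal.submodule_iSup_eq_top


/-! ## Differential Poisson superalgebras, Gel'fand-Dorfman superalgebras -/

/-- A Poisson superalgebra over `𝕜` (associative supercommutative product, not necessarily unital,
with a super Lie bracket satisfying the Leibniz rule), equipped with an even derivation `d` of
both operations. -/
structure DiffPoissonSuperalgebra (𝕜 : Type*) (P : Type*) [Field 𝕜] [AddCommGroup P] [Module 𝕜 P]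
    where
  grading : SuperGrading 𝕜 P
  mul : P →ₗ[𝕜] P →ₗ[𝕜] P
  bracket : P →ₗ[𝕜] P →ₗ[𝕜] P
  d : P →ₗ[𝕜] P
  mul_mem : ∀ {i j : ZMod 2} {a b : P}, a ∈ grading.part i → b ∈ grading.part j →
    mul a b ∈ grading.part (i + j)
  bracket_mem : ∀ {i j : ZMod 2} {a b : P}, a ∈ grading.part i → b ∈ grading.part j →
    bracket a b ∈ grading.part (i + j)
  d_mem : ∀ {i : ZMod 2} {a : P}, a ∈ grading.part i → d a ∈ grading.part i
  mul_assoc : ∀ a b c : P, mul (mul a b) c = mul a (mul b c)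
  mul_comm : ∀ {i j : ZMod 2} {a b : P}, a ∈ grading.part i → b ∈ grading.part j →
    mul a b = superSign i j • mul b a
  bracket_skew : ∀ {i j : ZMod 2} {a b : P}, a ∈ grading.part i → b ∈ grading.part j →
    bracket a b = -(superSign i j • bracket b a)
  bracket_jacobi : ∀ {i j : ZMod 2} {a b : P} (c : P), a ∈ grading.part i → b ∈ grading.part j →
    bracket a (bracket b c) = bracket (bracket a b) c + superSign i j • bracket b (bracket a c)
  leibniz : ∀ {i j : ZMod 2} {a b : P} (c : P), a ∈ grading.part i → b ∈ grading.part j →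
    bracket a (mul b c) = mul (bracket a b) c + superSign i j • mul b (bracket a c)
  d_mul : ∀ a b : P, d (mul a b) = mul (d a) b + mul a (d b)
  d_bracket : ∀ a b : P, d (bracket a b) = bracket (d a) b + bracket a (d b)

/-- A Gel'fand-Dorfman superalgebra: a superspace with a Novikov superproduct `a ∘ b = nov a b`
(left symmetric and right commutative) and a super Lie bracket `[a, b] = lie a b`,
related by the compatibility identity `compat`. -/
structure GDSuperalgebra (𝕜 : Type*) (V : Type*) [Field 𝕜] [AddCommGroup V] [Module 𝕜 V] where
  grading : SuperGrading 𝕜 V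
  nov : V →ₗ[𝕜] V →ₗ[𝕜] V
  lie : V →ₗ[𝕜] V →ₗ[𝕜] V
  nov_mem : ∀ {i j : ZMod 2} {a b : V}, a ∈ grading.part i → b ∈ grading.part j →
    nov a b ∈ grading.part (i + j)
  lie_mem : ∀ {i j : ZMod 2} {a b : V}, a ∈ grading.part i → b ∈ grading.part j →
    lie a b ∈ grading.part (i + j)
  left_symm : ∀ {i j : ZMod 2} {a b : V} (c : V), a ∈ grading.part i → b ∈ grading.part j →
    nov (nov a b) c - nov a (nov b c) = superSign i j • (nov (nov b a) c - nov b (nov a c))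
  right_comm : ∀ {j k : ZMod 2} (a : V) {b c : V}, b ∈ grading.part j → c ∈ grading.part k →
    nov (nov a b) c = superSign j k • nov (nov a c) b
  lie_skew : ∀ {i j : ZMod 2} {a b : V}, a ∈ grading.part i → b ∈ grading.part j →
    lie a b = -(superSign i j • lie b a)
  lie_jacobi : ∀ {i j : ZMod 2} {a b : V} (c : V), a ∈ grading.part i → b ∈ grading.part j →
    lie a (lie b c) = lie (lie a b) c + superSign i j • lie b (lie a c)
  compat : ∀ {i j k : ZMod 2} {a b c : V}, a ∈ grading.part i → b ∈ grading.part j →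
    c ∈ grading.part k →
    nov b (lie a c) = superSign i j • (lie a (nov b c) - nov (lie a b) c)
      - (superSign i k * superSign j k) • (lie c (nov b a) - nov (lie c b) a)

/-- A GD-superalgebra `V` is special if it embeds (by an even injective linear map) into a
differential Poisson superalgebra in such a way that `a ∘ b = a d(b)` and `[a, b] = {a, b}`. -/
def GDSuperalgebra.IsSpecial.{x, y, z} {𝕜 : Type y} {V : Type z} [Field 𝕜] [AddCommGroup V]
    [Module 𝕜 V] (G : GDSuperalgebra 𝕜 V) : Prop :=
  ∃ (P : Type x) (_ : AddCommGroup P) (_ : Module 𝕜 P) (𝔓 : DiffPoissonSuperalgebra 𝕜 P)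
    (τ : V →ₗ[𝕜] P), Function.Injective τ ∧
      (∀ i, ∀ a ∈ G.grading.part i, τ a ∈ 𝔓.grading.part i) ∧
      (∀ a b, τ (G.nov a b) = 𝔓.mul (τ a) (𝔓.d (τ b))) ∧
      (∀ a b, τ (G.lie a b) = 𝔓.bracket (τ a) (τ b))

/-! ## Polynomials in `λ` (and `μ`) with coefficients in a module

`M[λ]` is the space `ℕ →₀ M`: the function `f` stands for `∑ λ ^ n f(n)`.
`M[λ, μ]` is `ℕ →₀ (ℕ →₀ M)`: the function `f` stands for `∑ λ ^ m μ ^ n f(m)(n)`. -/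

section PolyModule

variable {𝕜 : Type*} {M N : Type*} [Field 𝕜] [AddCommGroup M] [AddCommGroup N]
  [Module 𝕜 M] [Module 𝕜 N]

/-- Constant polynomials: `M → M[λ]`. -/
noncomputable def polyConst : M →ₗ[𝕜] (ℕ →₀ M) := Finsupp.lsingle 0

/-- Multiplication by the variable: `f ↦ λ f` on `M[λ]`. -/
noncomputable def polyVar : Module.End 𝕜 (ℕ →₀ M) := Finsupp.lmapDomain M 𝕜 Nat.succ

/-- A linear map `φ : M → N` applied to every coefficient: `M[λ] → N[λ]`. -/
noncomputable def polyMap (φ : M →ₗ[𝕜] N) : (ℕ →₀ M) →ₗ[𝕜] (ℕ →₀ N) :=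
  Finsupp.mapRange.linearMap φ

/-- Substitution of an operator `T` on `N` for the variable:
`∑ λ ^ n x_n ↦ ∑ T ^ n φ(x_n)`. -/
noncomputable def polySubst (T : Module.End 𝕜 N) (φ : M →ₗ[𝕜] N) : (ℕ →₀ M) →ₗ[𝕜] N :=
  Finsupp.lsum 𝕜 (fun n => (T ^ n) ∘ₗ φ)

/-- Multiplication by `λ` on `M[λ, μ]`. -/
noncomputable def polyLam : Module.End 𝕜 (ℕ →₀ ℕ →₀ M) := polyVar

/-- Multiplication by `μ` on `M[λ, μ]`. -/
noncomputable def polyMu : Module.End 𝕜 (ℕ →₀ ℕ →₀ M) := polyMap polyVar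

/-- Constants: `M → M[λ, μ]`. -/
noncomputable def polyConst₂ : M →ₗ[𝕜] (ℕ →₀ ℕ →₀ M) := polyConst ∘ₗ polyConst

/-- `evalOp act T a x` is `(a_T x) ∈ M[λ, μ]`, the polynomial `act a x ∈ M[ν]` with the operator `T`
on `M[λ, μ]` (which is multiplication by `λ`, `μ` or `λ + μ` below) in place of `ν`. -/
noncomputable def evalOp {L : Type*} [AddCommGroup L] [Module 𝕜 L]
    (act : L →ₗ[𝕜] M →ₗ[𝕜] (ℕ →₀ M)) (T : Module.End 𝕜 (ℕ →₀ ℕ →₀ M)) :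
    L →ₗ[𝕜] M →ₗ[𝕜] (ℕ →₀ ℕ →₀ M) :=
  act.compr₂ (polySubst T polyConst₂)

/-- The left side of the conformal Jacobi identity:
`(a_λ (b_μ x)) - s (b_μ (a_λ x)) ∈ M[λ, μ]`, for a sign `s`. -/
noncomputable def jacobiLeft {L : Type*} [AddCommGroup L] [Module 𝕜 L]
    (act : L →ₗ[𝕜] M →ₗ[𝕜] (ℕ →₀ M)) (s : ℤ) (a b : L) (x : M) : ℕ →₀ ℕ →₀ M :=
  polySubst polyMu (evalOp act polyLam a) (act b x)
    - s • polySubst polyLam (evalOp act polyMu b) (act a x)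

/-- The right side of the conformal Jacobi identity:
`([a_λ b]_{λ+μ} x) ∈ M[λ, μ]`. -/
noncomputable def jacobiRight {L : Type*} [AddCommGroup L] [Module 𝕜 L]
    (bracket : L →ₗ[𝕜] L →ₗ[𝕜] (ℕ →₀ L)) (act : L →ₗ[𝕜] M →ₗ[𝕜] (ℕ →₀ M))
    (a b : L) (x : M) : ℕ →₀ ℕ →₀ M :=
  polySubst polyLam ((evalOp act (polyLam + polyMu)).flip x) (bracket a b)

/-- The action of `∂` on a module over `H = 𝕜[∂]`. -/
noncomputable def del [Module 𝕜[X] M] [IsScalarTower 𝕜 𝕜[X] M] : Module.End 𝕜 M :=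
  Algebra.lsmul 𝕜 𝕜 M (X : 𝕜[X])

end PolyModule

/-! ## Lie conformal superalgebras and their representations -/

/-- A Lie conformal superalgebra structure on an `H`-module `L`, where `H = 𝕜[∂]` is `𝕜[X]`. -/
structure LieConformalSuperalgebra (𝕜 : Type*) (L : Type*) [Field 𝕜] [AddCommGroup L] [Module 𝕜 L]
    [Module 𝕜[X] L] [IsScalarTower 𝕜 𝕜[X] L] where
  grading : SuperGrading 𝕜[X] L
  /-- The bracket `[a_λ b] ∈ L[λ]`. -/
  bracket : L →ₗ[𝕜] L →ₗ[𝕜] (ℕ →₀ L)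
  bracket_mem : ∀ {i j : ZMod 2} {a b : L}, a ∈ grading.part i → b ∈ grading.part j →
    ∀ n, bracket a b n ∈ grading.part (i + j)
  /-- `[∂a_λ b] = -λ [a_λ b]` -/
  bracket_del_left : ∀ a b : L, bracket (del (𝕜 := 𝕜) a) b = -polyVar (𝕜 := 𝕜) (bracket a b)
  /-- `[a_λ ∂b] = (∂ + λ) [a_λ b]` -/
  bracket_del_right : ∀ a b : L,
    bracket a (del (𝕜 := 𝕜) b) = (polyMap del + polyVar : Module.End 𝕜 (ℕ →₀ L)) (bracket a b)
  /-- `[a_λ b] = -(-1)^{|a||b|} [b_{-∂-λ} a]` -/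
  bracket_skew : ∀ {i j : ZMod 2} {a b : L}, a ∈ grading.part i → b ∈ grading.part j →
    bracket a b = -(superSign i j •
      polySubst (-polyMap del - polyVar : Module.End 𝕜 (ℕ →₀ L)) polyConst (bracket b a))
  /-- `[a_λ [b_μ c]] - (-1)^{|a||b|} [b_μ [a_λ c]] = [[a_λ b]_{λ+μ} c]` -/
  jacobi : ∀ {i j : ZMod 2} {a b : L} (c : L), a ∈ grading.part i → b ∈ grading.part j →
    jacobiLeft bracket (superSign i j) a b c = jacobiRight bracket bracket a b c

/-- A conformal representation of a Lie conformal superalgebra on a `ℤ/2ℤ`-graded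
`H`-module `M`. -/
structure ConformalRep {𝕜 : Type*} {L : Type*} [Field 𝕜] [AddCommGroup L] [Module 𝕜 L]
    [Module 𝕜[X] L] [IsScalarTower 𝕜 𝕜[X] L] (𝔏 : LieConformalSuperalgebra 𝕜 L)
    (M : Type*) [AddCommGroup M] [Module 𝕜 M] [Module 𝕜[X] M] [IsScalarTower 𝕜 𝕜[X] M] where
  grading : SuperGrading 𝕜[X] M
  /-- The action `ρ_λ(a, x) ∈ M[λ]`. -/
  act : L →ₗ[𝕜] M →ₗ[𝕜] (ℕ →₀ M)
  act_mem : ∀ {i j : ZMod 2} {a : L} {x : M}, a ∈ 𝔏.grading.part i → x ∈ grading.part j →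
    ∀ n, act a x n ∈ grading.part (i + j)
  act_del_left : ∀ (a : L) (x : M), act (del (𝕜 := 𝕜) a) x = -polyVar (𝕜 := 𝕜) (act a x)
  act_del_right : ∀ (a : L) (x : M),
    act a (del (𝕜 := 𝕜) x) = (polyMap del + polyVar : Module.End 𝕜 (ℕ →₀ M)) (act a x)
  jacobi : ∀ {i j : ZMod 2} {a b : L} (x : M), a ∈ 𝔏.grading.part i → b ∈ 𝔏.grading.part j →
    jacobiLeft act (superSign i j) a b x = jacobiRight 𝔏.bracket act a b x

/-- A representation is faithful if no nonzero element of `L` acts by zero. -/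
def ConformalRep.IsFaithful {𝕜 : Type*} {L : Type*} [Field 𝕜] [AddCommGroup L] [Module 𝕜 L]
    [Module 𝕜[X] L] [IsScalarTower 𝕜 𝕜[X] L] {𝔏 : LieConformalSuperalgebra 𝕜 L}
    {M : Type*} [AddCommGroup M] [Module 𝕜 M] [Module 𝕜[X] M] [IsScalarTower 𝕜 𝕜[X] M]
    (ρ : ConformalRep 𝔏 M) : Prop :=
  Function.Injective ρ.act

/-- `L` has a finite faithful conformal representation: a faithful one on a finitely generated
`H`-module. -/
def LieConformalSuperalgebra.HasFFR.{x, y, z} {𝕜 : Type y} {L : Type z} [Field 𝕜] [AddCommGroup L]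
    [Module 𝕜 L] [Module 𝕜[X] L] [IsScalarTower 𝕜 𝕜[X] L]
    (𝔏 : LieConformalSuperalgebra 𝕜 L) : Prop :=
  ∃ (M : Type x) (_ : AddCommGroup M) (_ : Module 𝕜 M) (_ : Module 𝕜[X] M)
    (_ : IsScalarTower 𝕜 𝕜[X] M) (ρ : ConformalRep 𝔏 M),
    Module.Finite 𝕜[X] M ∧ ρ.IsFaithful

/-! ### Computation rules -/

section PolyRules

variable {𝕜 : Type*} {M N K : Type*} [Field 𝕜] [AddCommGroup M] [AddCommGroup N] [AddCommGroup K]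
  [Module 𝕜 M] [Module 𝕜 N] [Module 𝕜 K]

theorem polySubst_single (T : Module.End 𝕜 N) (φ : M →ₗ[𝕜] N) (n : ℕ) (x : M) :
    polySubst T φ (Finsupp.single n x) = (T ^ n) (φ x) := by
  simp [polySubst]

theorem polySubst_const (T : Module.End 𝕜 N) (φ : M →ₗ[𝕜] N) (x : M) :
    polySubst T φ (polyConst (𝕜 := 𝕜) x) = φ x := by
  simp [polyConst, polySubst_single]

theorem polySubst_var (T : Module.End 𝕜 N) (φ : M →ₗ[𝕜] N) (f : ℕ →₀ M) :
    polySubst T φ (polyVar (𝕜 := 𝕜) f) = T (polySubst T φ f) := by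
  induction f using Finsupp.induction_linear with
  | zero => simp
  | add f g hf hg => simp [hf, hg]
  | single n x => simp [polyVar, Finsupp.mapDomain_single, polySubst_single, pow_succ']

theorem polySubst_map (T : Module.End 𝕜 N) (φ : M →ₗ[𝕜] N) (ψ : K →ₗ[𝕜] M) (f : ℕ →₀ K) :
    polySubst T φ (polyMap ψ f) = polySubst T (φ ∘ₗ ψ) f := by
  induction f using Finsupp.induction_linear with
  | zero => simp
  | add f g hf hg => simp [hf, hg]
  | single n x => simp [polyMap, polySubst_single]

/-- An operator commuting with the substituted one passes through a substitution. -/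
theorem polySubst_comm (T S : Module.End 𝕜 N) (h : Commute S T) (φ : M →ₗ[𝕜] N) (f : ℕ →₀ M) :
    polySubst T (S ∘ₗ φ) f = S (polySubst T φ f) := by
  induction f using Finsupp.induction_linear with
  | zero => simp
  | add f g hf hg => simp [hf, hg]
  | single n x =>
    simp only [polySubst_single, LinearMap.comp_apply]
    exact (LinearMap.congr_fun (h.pow_right n).eq (φ x)).symm

theorem polyMap_const (ψ : M →ₗ[𝕜] N) (x : M) :
    polyMap ψ (polyConst (𝕜 := 𝕜) x) = polyConst (𝕜 := 𝕜) (ψ x) := by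
  simp [polyMap, polyConst]

theorem polyMap_var (ψ : M →ₗ[𝕜] N) (f : ℕ →₀ M) :
    polyMap ψ (polyVar (𝕜 := 𝕜) f) = polyVar (𝕜 := 𝕜) (polyMap ψ f) := by
  induction f using Finsupp.induction_linear with
  | zero => simp
  | add f g hf hg => simp [hf, hg]
  | single n x => simp [polyMap, polyVar, Finsupp.mapDomain_single]

theorem commute_polyMap_polyVar (ψ : Module.End 𝕜 M) :
    Commute (polyMap ψ : Module.End 𝕜 (ℕ →₀ M)) polyVar :=
  LinearMap.ext fun f => polyMap_var ψ f

theorem commute_polyMap_polyMap {ψ χ : Module.End 𝕜 M} (h : Commute ψ χ) :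
    Commute (polyMap ψ : Module.End 𝕜 (ℕ →₀ M)) (polyMap χ) := by
  refine LinearMap.ext fun f => Finsupp.ext fun n => ?_
  simpa [polyMap] using LinearMap.congr_fun h.eq (f n)


theorem commute_neg_left {S T : Module.End 𝕜 M} (h : Commute S T) : Commute (-S) T :=
  h.neg_left

theorem polySubst_add_map (T : Module.End 𝕜 N) (φ ψ : M →ₗ[𝕜] N) (f : ℕ →₀ M) :
    polySubst T (φ + ψ) f = polySubst T φ f + polySubst T ψ f := by
  induction f using Finsupp.induction_linear with
  | zero => simp
  | add f g hf hg => rw [map_add, map_add, map_add, hf, hg]; abel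
  | single n x => simp [polySubst_single]

theorem polySubst_smul_map (T : Module.End 𝕜 N) (c : 𝕜) (φ : M →ₗ[𝕜] N) (f : ℕ →₀ M) :
    polySubst T (c • φ) f = c • polySubst T φ f := by
  induction f using Finsupp.induction_linear with
  | zero => simp
  | add f g hf hg => simp [hf, hg]
  | single n x => simp [polySubst_single]

theorem commute_polyLam_polyMu :
    Commute (polyLam : Module.End 𝕜 (ℕ →₀ ℕ →₀ M)) polyMu :=
  (commute_polyMap_polyVar (polyVar : Module.End 𝕜 (ℕ →₀ M))).symm

variable [Module 𝕜[X] M] [IsScalarTower 𝕜 𝕜[X] M]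

/-- The action of `∂` on `M[λ, μ]`. -/
noncomputable def polyDel₂ : Module.End 𝕜 (ℕ →₀ ℕ →₀ M) := polyMap (polyMap del)

theorem commute_polyLam_polyDel₂ :
    Commute (polyLam : Module.End 𝕜 (ℕ →₀ ℕ →₀ M)) polyDel₂ :=
  (commute_polyMap_polyVar (polyMap del : Module.End 𝕜 (ℕ →₀ M))).symm

theorem commute_polyMu_polyDel₂ :
    Commute (polyMu : Module.End 𝕜 (ℕ →₀ ℕ →₀ M)) polyDel₂ :=
  commute_polyMap_polyMap (commute_polyMap_polyVar (del : Module.End 𝕜 M)).symm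

theorem polyDel₂_const₂ (x : M) :
    polyDel₂ (𝕜 := 𝕜) (polyConst₂ (𝕜 := 𝕜) x) = polyConst₂ (𝕜 := 𝕜) (del (𝕜 := 𝕜) x) := by
  simp [polyDel₂, polyConst₂, polyMap_const]

variable {L : Type*} [AddCommGroup L] [Module 𝕜 L] [Module 𝕜[X] L] [IsScalarTower 𝕜 𝕜[X] L]
  {act : L →ₗ[𝕜] M →ₗ[𝕜] (ℕ →₀ M)} {bracket : L →ₗ[𝕜] L →ₗ[𝕜] (ℕ →₀ L)}

theorem evalOp_del_left
    (hl : ∀ a x, act (del (𝕜 := 𝕜) a) x = -polyVar (𝕜 := 𝕜) (act a x))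
    (T : Module.End 𝕜 (ℕ →₀ ℕ →₀ M)) (a : L) (x : M) :
    evalOp act T (del (𝕜 := 𝕜) a) x = -T (evalOp act T a x) := by
  simp [evalOp, hl, polySubst_var]

theorem evalOp_del_right
    (hr : ∀ a x, act a (del (𝕜 := 𝕜) x) =
      (polyMap del + polyVar : Module.End 𝕜 (ℕ →₀ M)) (act a x))
    (T : Module.End 𝕜 (ℕ →₀ ℕ →₀ M)) (hT : Commute T polyDel₂) (a : L) (x : M) :
    evalOp act T a (del (𝕜 := 𝕜) x) = polyDel₂ (𝕜 := 𝕜) (evalOp act T a x) + T (evalOp act T a x) := by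
  simp only [evalOp, LinearMap.compr₂_apply, hr, LinearMap.add_apply, map_add, polySubst_var,
    polySubst_map]
  have h : (polyConst₂ ∘ₗ del : M →ₗ[𝕜] (ℕ →₀ ℕ →₀ M)) = polyDel₂ ∘ₗ polyConst₂ :=
    LinearMap.ext fun x => (polyDel₂_const₂ x).symm
  rw [h, polySubst_comm _ _ hT.symm]

theorem jacobiLeft_del_left
    (hl : ∀ a x, act (del (𝕜 := 𝕜) a) x = -polyVar (𝕜 := 𝕜) (act a x))
    (s : ℤ) (a b : L) (x : M) :
    jacobiLeft act s (del (𝕜 := 𝕜) a) b x = -polyLam (𝕜 := 𝕜) (jacobiLeft act s a b x) := by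
  have h : evalOp act polyLam (del (𝕜 := 𝕜) a) = (-polyLam) ∘ₗ evalOp act polyLam a :=
    LinearMap.ext fun y => evalOp_del_left hl _ a y
  rw [jacobiLeft, jacobiLeft, h, polySubst_comm _ _ (commute_neg_left commute_polyLam_polyMu), hl, map_neg,
    polySubst_var, map_sub, map_zsmul]
  simp only [LinearMap.neg_apply, smul_neg]
  abel

theorem jacobiLeft_del_mid
    (hl : ∀ a x, act (del (𝕜 := 𝕜) a) x = -polyVar (𝕜 := 𝕜) (act a x))
    (s : ℤ) (a b : L) (x : M) :
    jacobiLeft act s a (del (𝕜 := 𝕜) b) x = -polyMu (𝕜 := 𝕜) (jacobiLeft act s a b x) := by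
  have h : evalOp act polyMu (del (𝕜 := 𝕜) b) = (-polyMu) ∘ₗ evalOp act polyMu b :=
    LinearMap.ext fun y => evalOp_del_left hl _ b y
  rw [jacobiLeft, jacobiLeft, h, polySubst_comm _ _ (commute_neg_left commute_polyLam_polyMu.symm), hl,
    map_neg, polySubst_var, map_sub, map_zsmul]
  simp only [LinearMap.neg_apply, smul_neg]
  abel

theorem jacobiLeft_del_right
    (hr : ∀ a x, act a (del (𝕜 := 𝕜) x) =
      (polyMap del + polyVar : Module.End 𝕜 (ℕ →₀ M)) (act a x))
    (s : ℤ) (a b : L) (x : M) :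
    jacobiLeft act s a b (del (𝕜 := 𝕜) x) =
      (polyDel₂ + polyLam + polyMu : Module.End 𝕜 (ℕ →₀ ℕ →₀ M)) (jacobiLeft act s a b x) := by
  have h1 : evalOp act polyLam a ∘ₗ del = (polyDel₂ + polyLam) ∘ₗ evalOp act polyLam a :=
    LinearMap.ext fun y => evalOp_del_right hr _ commute_polyLam_polyDel₂ a y
  have h2 : evalOp act polyMu b ∘ₗ del = (polyDel₂ + polyMu) ∘ₗ evalOp act polyMu b :=
    LinearMap.ext fun y => evalOp_del_right hr _ commute_polyMu_polyDel₂ b y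
  have c1 : Commute (polyDel₂ + polyLam : Module.End 𝕜 (ℕ →₀ ℕ →₀ M)) polyMu :=
    commute_polyMu_polyDel₂.symm.add_left commute_polyLam_polyMu
  have c2 : Commute (polyDel₂ + polyMu : Module.End 𝕜 (ℕ →₀ ℕ →₀ M)) polyLam :=
    commute_polyLam_polyDel₂.symm.add_left commute_polyLam_polyMu.symm
  simp only [jacobiLeft, hr, LinearMap.add_apply, map_add, polySubst_map, polySubst_var, h1, h2,
    polySubst_comm _ _ c1, polySubst_comm _ _ c2, map_sub, map_zsmul, smul_add]
  abel

theorem jacobiRight_del_left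
    (bl : ∀ a b, bracket (del (𝕜 := 𝕜) a) b = -polyVar (𝕜 := 𝕜) (bracket a b))
    (a b : L) (x : M) :
    jacobiRight bracket act (del (𝕜 := 𝕜) a) b x =
      -polyLam (𝕜 := 𝕜) (jacobiRight bracket act a b x) := by
  simp only [jacobiRight, bl, map_neg, polySubst_var]

theorem jacobiRight_del_mid
    (hl : ∀ a x, act (del (𝕜 := 𝕜) a) x = -polyVar (𝕜 := 𝕜) (act a x))
    (br : ∀ a b, bracket a (del (𝕜 := 𝕜) b) =
      (polyMap del + polyVar : Module.End 𝕜 (ℕ →₀ L)) (bracket a b))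
    (a b : L) (x : M) :
    jacobiRight bracket act a (del (𝕜 := 𝕜) b) x =
      -polyMu (𝕜 := 𝕜) (jacobiRight bracket act a b x) := by
  have h : (evalOp act (polyLam + polyMu)).flip x ∘ₗ del =
      (-(polyLam + polyMu)) ∘ₗ (evalOp act (polyLam + polyMu)).flip x :=
    LinearMap.ext fun y => evalOp_del_left hl _ y x
  have c : Commute (-(polyLam + polyMu) : Module.End 𝕜 (ℕ →₀ ℕ →₀ M)) polyLam :=
    commute_neg_left ((Commute.refl polyLam).add_left commute_polyLam_polyMu.symm)
  simp only [jacobiRight, br, LinearMap.add_apply, map_add, polySubst_map, polySubst_var, h,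
    polySubst_comm _ _ c, LinearMap.neg_apply]
  abel

theorem jacobiRight_del_right
    (hr : ∀ a x, act a (del (𝕜 := 𝕜) x) =
      (polyMap del + polyVar : Module.End 𝕜 (ℕ →₀ M)) (act a x))
    (a b : L) (x : M) :
    jacobiRight bracket act a b (del (𝕜 := 𝕜) x) =
      (polyDel₂ + polyLam + polyMu : Module.End 𝕜 (ℕ →₀ ℕ →₀ M))
        (jacobiRight bracket act a b x) := by
  have c0 : Commute (polyLam + polyMu : Module.End 𝕜 (ℕ →₀ ℕ →₀ M)) polyDel₂ :=
    commute_polyLam_polyDel₂.add_left commute_polyMu_polyDel₂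
  have h : (evalOp act (polyLam + polyMu)).flip (del (𝕜 := 𝕜) x) =
      (polyDel₂ + polyLam + polyMu) ∘ₗ (evalOp act (polyLam + polyMu)).flip x := by
    refine LinearMap.ext fun y => (evalOp_del_right hr _ c0 y x).trans ?_
    simp [add_assoc]
  have c : Commute (polyDel₂ + polyLam + polyMu : Module.End 𝕜 (ℕ →₀ ℕ →₀ M)) polyLam :=
    (commute_polyLam_polyDel₂.symm.add_left (Commute.refl polyLam)).add_left
      commute_polyLam_polyMu.symm
  rw [jacobiRight, h, polySubst_comm _ _ c, jacobiRight]

theorem jacobiLeft_add_left (s : ℤ) (a b : L) (x : M) (y : L) :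
    jacobiLeft act s (a + y) b x =
      jacobiLeft act s a b x + jacobiLeft act s y b x := by
  simp only [jacobiLeft, map_add, map_smul, LinearMap.add_apply, LinearMap.smul_apply,
    polySubst_add_map, polySubst_smul_map]
  module

theorem jacobiLeft_add_mid (s : ℤ) (a b : L) (x : M) (y : L) :
    jacobiLeft act s a (b + y) x =
      jacobiLeft act s a b x + jacobiLeft act s a y x := by
  simp only [jacobiLeft, map_add, map_smul, LinearMap.add_apply, LinearMap.smul_apply,
    polySubst_add_map, polySubst_smul_map]
  module

theorem jacobiLeft_add_right (s : ℤ) (a b : L) (x : M) (y : M) :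
    jacobiLeft act s a b (x + y) =
      jacobiLeft act s a b x + jacobiLeft act s a b y := by
  simp only [jacobiLeft, map_add, map_smul, LinearMap.add_apply, LinearMap.smul_apply,
    polySubst_add_map, polySubst_smul_map]
  module

theorem jacobiLeft_smul_left (s : ℤ) (c : 𝕜) (a b : L) (x : M) :
    jacobiLeft act s (c • a) b x =
      c • jacobiLeft act s a b x := by
  simp only [jacobiLeft, map_add, map_smul, LinearMap.add_apply, LinearMap.smul_apply,
    polySubst_add_map, polySubst_smul_map]
  module

theorem jacobiLeft_smul_mid (s : ℤ) (c : 𝕜) (a b : L) (x : M) :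
    jacobiLeft act s a (c • b) x =
      c • jacobiLeft act s a b x := by
  simp only [jacobiLeft, map_add, map_smul, LinearMap.add_apply, LinearMap.smul_apply,
    polySubst_add_map, polySubst_smul_map]
  module

theorem jacobiLeft_smul_right (s : ℤ) (c : 𝕜) (a b : L) (x : M) :
    jacobiLeft act s a b (c • x) =
      c • jacobiLeft act s a b x := by
  simp only [jacobiLeft, map_add, map_smul, LinearMap.add_apply, LinearMap.smul_apply,
    polySubst_add_map, polySubst_smul_map]
  module

theorem jacobiRight_add_left (a b : L) (x : M) (y : L) :
    jacobiRight bracket act (a + y) b x =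
      jacobiRight bracket act a b x + jacobiRight bracket act y b x := by
  simp only [jacobiRight, map_add, map_smul, LinearMap.add_apply, LinearMap.smul_apply,
    polySubst_add_map, polySubst_smul_map]

theorem jacobiRight_add_mid (a b : L) (x : M) (y : L) :
    jacobiRight bracket act a (b + y) x =
      jacobiRight bracket act a b x + jacobiRight bracket act a y x := by
  simp only [jacobiRight, map_add, map_smul, LinearMap.add_apply, LinearMap.smul_apply,
    polySubst_add_map, polySubst_smul_map]

theorem jacobiRight_add_right (a b : L) (x : M) (y : M) :
    jacobiRight bracket act a b (x + y) =
      jacobiRight bracket act a b x + jacobiRight bracket act a b y := by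
  simp only [jacobiRight, map_add, map_smul, LinearMap.add_apply, LinearMap.smul_apply,
    polySubst_add_map, polySubst_smul_map]

theorem jacobiRight_smul_left (c : 𝕜) (a b : L) (x : M) :
    jacobiRight bracket act (c • a) b x =
      c • jacobiRight bracket act a b x := by
  simp only [jacobiRight, map_add, map_smul, LinearMap.add_apply, LinearMap.smul_apply,
    polySubst_add_map, polySubst_smul_map]

theorem jacobiRight_smul_mid (c : 𝕜) (a b : L) (x : M) :
    jacobiRight bracket act a (c • b) x =
      c • jacobiRight bracket act a b x := by
  simp only [jacobiRight, map_add, map_smul, LinearMap.add_apply, LinearMap.smul_apply,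
    polySubst_add_map, polySubst_smul_map]

theorem jacobiRight_smul_right (c : 𝕜) (a b : L) (x : M) :
    jacobiRight bracket act a b (c • x) =
      c • jacobiRight bracket act a b x := by
  simp only [jacobiRight, map_add, map_smul, LinearMap.add_apply, LinearMap.smul_apply,
    polySubst_add_map, polySubst_smul_map]

end PolyRules

/-! ## Quadratic Lie conformal superalgebras -/

section Sesquilinear

variable {𝕜 : Type*} {V W N : Type*} [Field 𝕜] [AddCommGroup V] [AddCommGroup W] [AddCommGroup N]
  [Module 𝕜 V] [Module 𝕜 W] [Module 𝕜 N]

/-- The extension of `φ : W → N` to `H ⊗ W → N` along which `∂` goes to the operator `T`: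
`f(∂) ⊗ w ↦ f(T) φ(w)`. -/
noncomputable def freeExt (T : Module.End 𝕜 N) :
    (W →ₗ[𝕜] N) →ₗ[𝕜] (𝕜[X] ⊗[𝕜] W →ₗ[𝕜] N) :=
  (TensorProduct.lift.equiv (RingHom.id 𝕜) 𝕜[X] W N).toLinearMap ∘ₗ
    ((LinearMap.llcomp 𝕜 W N N) ∘ₗ (aeval T).toLinearMap).flip

theorem freeExt_tmul (T : Module.End 𝕜 N) (φ : W →ₗ[𝕜] N) (f : 𝕜[X]) (w : W) :
    freeExt T φ (f ⊗ₜ w) = aeval T f (φ w) := by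
  simp [freeExt]

theorem freeExt_one (T : Module.End 𝕜 N) (φ : W →ₗ[𝕜] N) (w : W) :
    freeExt T φ ((1 : 𝕜[X]) ⊗ₜ w) = φ w := by
  simp [freeExt_tmul]

theorem freeExt_del (T : Module.End 𝕜 N) (φ : W →ₗ[𝕜] N) (z : 𝕜[X] ⊗[𝕜] W) :
    freeExt T φ (del (𝕜 := 𝕜) z) = T (freeExt T φ z) := by
  induction z with
  | zero => simp
  | add x y hx hy => simp [hx, hy]
  | tmul f w => simp [del, freeExt_tmul, TensorProduct.smul_tmul']

/-- The sesquilinear extension `(H ⊗ V) × (H ⊗ W) → (H ⊗ W)[λ]` of a bilinear map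
`β : V × W → (H ⊗ W)[λ]`: `(f(∂) v, g(∂) w) ↦ f(-λ) g(∂ + λ) β(v, w)`. -/
noncomputable def sesquiExt (β : V →ₗ[𝕜] W →ₗ[𝕜] (ℕ →₀ 𝕜[X] ⊗[𝕜] W)) :
    𝕜[X] ⊗[𝕜] V →ₗ[𝕜] 𝕜[X] ⊗[𝕜] W →ₗ[𝕜] (ℕ →₀ 𝕜[X] ⊗[𝕜] W) :=
  freeExt (LinearMap.llcomp 𝕜 _ _ _ (-polyVar : Module.End 𝕜 (ℕ →₀ 𝕜[X] ⊗[𝕜] W)))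
    (freeExt (polyMap del + polyVar) ∘ₗ β)

theorem sesquiExt_one (β : V →ₗ[𝕜] W →ₗ[𝕜] (ℕ →₀ 𝕜[X] ⊗[𝕜] W)) (v : V) (w : W) :
    sesquiExt β ((1 : 𝕜[X]) ⊗ₜ v) ((1 : 𝕜[X]) ⊗ₜ w) = β v w := by
  simp [sesquiExt, freeExt_one]

theorem sesquiExt_del_left (β : V →ₗ[𝕜] W →ₗ[𝕜] (ℕ →₀ 𝕜[X] ⊗[𝕜] W)) (x : 𝕜[X] ⊗[𝕜] V)
    (y : 𝕜[X] ⊗[𝕜] W) :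
    sesquiExt β (del (𝕜 := 𝕜) x) y = -polyVar (𝕜 := 𝕜) (sesquiExt β x y) := by
  simp [sesquiExt, freeExt_del]

theorem sesquiExt_del_right (β : V →ₗ[𝕜] W →ₗ[𝕜] (ℕ →₀ 𝕜[X] ⊗[𝕜] W)) (x : 𝕜[X] ⊗[𝕜] V)
    (y : 𝕜[X] ⊗[𝕜] W) :
    sesquiExt β x (del (𝕜 := 𝕜) y) =
      (polyMap del + polyVar : Module.End 𝕜 (ℕ →₀ 𝕜[X] ⊗[𝕜] W)) (sesquiExt β x y) := by
  have hc : Commute (-polyVar : Module.End 𝕜 (ℕ →₀ 𝕜[X] ⊗[𝕜] W)) (polyMap del + polyVar) :=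
    ((commute_polyMap_polyVar (del : Module.End 𝕜 (𝕜[X] ⊗[𝕜] W))).symm.add_right
      (Commute.refl polyVar)).neg_left
  induction x generalizing y with
  | zero => simp
  | add u v hu hv => 
    simp only [map_add, LinearMap.add_apply] at hu hv ⊢
    rw [hu, hv]
  | tmul f v =>
    have key : ∀ f : 𝕜[X], ∀ z : 𝕜[X] ⊗[𝕜] W, sesquiExt β (f ⊗ₜ v) z =
        aeval (-polyVar : Module.End 𝕜 (ℕ →₀ 𝕜[X] ⊗[𝕜] W)) f
          (freeExt (polyMap del + polyVar) (β v) z) := by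
      intro f z
      have h2 : ∀ (n : ℕ), ((LinearMap.llcomp 𝕜 (𝕜[X] ⊗[𝕜] W) _ _
          (-polyVar : Module.End 𝕜 (ℕ →₀ 𝕜[X] ⊗[𝕜] W))) ^ n)
            (freeExt (polyMap del + polyVar) (β v)) z =
          ((-polyVar : Module.End 𝕜 (ℕ →₀ 𝕜[X] ⊗[𝕜] W)) ^ n)
            (freeExt (polyMap del + polyVar) (β v) z) := by
        intro n
        induction n with
        | zero => simp
        | succ n ih => rw [pow_succ', pow_succ', Module.End.mul_apply, Module.End.mul_apply, ← ih]; rfl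
      rw [sesquiExt, freeExt_tmul]
      induction f using Polynomial.induction_on' with
      | add p q hp hq => simp only [map_add, LinearMap.add_apply, hp, hq]
      | monomial n c => 
        simp only [aeval_monomial, Module.End.mul_apply, LinearMap.comp_apply, 
          Module.algebraMap_end_apply, LinearMap.smul_apply, h2]
    rw [key, key, freeExt_del]
    have hc2 : Commute (aeval (-polyVar : Module.End 𝕜 (ℕ →₀ 𝕜[X] ⊗[𝕜] W)) f)
        (polyMap del + polyVar) := by
      induction f using Polynomial.induction_on' with
      | add p q hp hq => simpa using hp.add_left hq
      | monomial n c =>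
        rw [aeval_monomial]
        exact (Algebra.commute_algebraMap_left _ _).mul_left (hc.pow_left n)
    exact LinearMap.congr_fun hc2.eq _

end Sesquilinear

namespace GDSuperalgebra

variable {𝕜 V : Type*} [Field 𝕜] [AddCommGroup V] [Module 𝕜 V] (G : GDSuperalgebra 𝕜 V)

/-- The opposite product: `(a, b) ↦ (-1)^{|a||b|} b ∘ a` for homogeneous `a`, `b`. -/
noncomputable def novOp : V →ₗ[𝕜] V →ₗ[𝕜] V :=
  ∑ i : ZMod 2, ∑ j : ZMod 2,
    superSign i j • (G.nov.compl₁₂ (G.grading.proj j) (G.grading.proj i)).flip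

theorem novOp_apply {i j : ZMod 2} {a b : V} (ha : a ∈ G.grading.part i)
    (hb : b ∈ G.grading.part j) : G.novOp a b = superSign i j • G.nov b a := by
  simp only [novOp, LinearMap.sum_apply, LinearMap.smul_apply, LinearMap.flip_apply,
    LinearMap.compl₁₂_apply, G.grading.proj_of_mem _ ha, G.grading.proj_of_mem _ hb]
  rw [Finset.sum_eq_single i, Finset.sum_eq_single j] <;> simp +contextual

/-- The quadratic bracket on generators:
`[a_λ b] = [a, b] + ∂ ((-1)^{|a||b|} b ∘ a) + λ (a ∘ b + (-1)^{|a||b|} b ∘ a)`. -/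
noncomputable def quadraticBracket₀ : V →ₗ[𝕜] V →ₗ[𝕜] (ℕ →₀ 𝕜[X] ⊗[𝕜] V) :=
  let ι : V →ₗ[𝕜] 𝕜[X] ⊗[𝕜] V := TensorProduct.mk 𝕜 𝕜[X] V 1
  G.lie.compr₂ (polyConst ∘ₗ ι) + G.novOp.compr₂ (polyConst ∘ₗ del ∘ₗ ι)
    + (G.nov + G.novOp).compr₂ (polyVar ∘ₗ polyConst ∘ₗ ι)

/-- The quadratic bracket on `H ⊗ V`. -/
noncomputable def quadraticBracket :
    𝕜[X] ⊗[𝕜] V →ₗ[𝕜] 𝕜[X] ⊗[𝕜] V →ₗ[𝕜] (ℕ →₀ 𝕜[X] ⊗[𝕜] V) :=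
  sesquiExt G.quadraticBracket₀

theorem quadraticBracket_one (u v : V) :
    G.quadraticBracket ((1 : 𝕜[X]) ⊗ₜ u) ((1 : 𝕜[X]) ⊗ₜ v) =
      polyConst (𝕜 := 𝕜) ((1 : 𝕜[X]) ⊗ₜ[𝕜] G.lie u v)
        + polyConst (𝕜 := 𝕜) (del (𝕜 := 𝕜) ((1 : 𝕜[X]) ⊗ₜ[𝕜] G.novOp u v))
        + polyVar (𝕜 := 𝕜) (polyConst (𝕜 := 𝕜)
            ((1 : 𝕜[X]) ⊗ₜ[𝕜] (G.nov u v + G.novOp u v))) := by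
  simp [quadraticBracket, sesquiExt_one, quadraticBracket₀]

/-- To prove a property of all elements of `H ⊗ U`, check it on generators and show that it is
stable under the vector space operations and `∂`. -/
theorem baseChange_induction (U : Submodule 𝕜 V) {p : 𝕜[X] ⊗[𝕜] V → Prop}
    (one : ∀ u ∈ U, p ((1 : 𝕜[X]) ⊗ₜ u)) (add : ∀ x y, p x → p y → p (x + y))
    (smul : ∀ (c : 𝕜) x, p x → p (c • x)) (hdel : ∀ x, p x → p (del (𝕜 := 𝕜) x))
    {a : 𝕜[X] ⊗[𝕜] V} (ha : a ∈ U.baseChange 𝕜[X]) : p a := by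
  rw [Submodule.baseChange_eq_span] at ha
  induction ha using Submodule.span_induction with
  | mem x hx =>
    obtain ⟨u, hu, rfl⟩ := hx
    exact one u hu
  | zero => simpa using one 0 U.zero_mem
  | add x y _ _ hx hy => exact add x y hx hy
  | smul f x _ hx =>
    induction f using Polynomial.induction_on' with
    | add f g hf hg => rw [add_smul]; exact add _ _ hf hg
    | monomial n c =>
      have hX : ∀ n : ℕ, p ((X ^ n : 𝕜[X]) • x) := by
        intro n
        induction n with
        | zero => simpa using hx
        | succ n ih =>
          rw [pow_succ', mul_smul]
          exact hdel _ ih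
      rw [← C_mul_X_pow_eq_monomial, mul_smul, ← algebraMap_eq, algebraMap_smul]
      exact smul c _ (hX n)

theorem quadraticBracket_mem {i j : ZMod 2} {a b : 𝕜[X] ⊗[𝕜] V}
    (ha : a ∈ (G.grading.part i).baseChange 𝕜[X]) (hb : b ∈ (G.grading.part j).baseChange 𝕜[X])
    (n : ℕ) : G.quadraticBracket a b n ∈ (G.grading.part (i + j)).baseChange 𝕜[X] := by
  have hvar : ∀ f : ℕ →₀ 𝕜[X] ⊗[𝕜] V,
      (∀ n, f n ∈ (G.grading.part (i + j)).baseChange 𝕜[X]) →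
      ∀ n, polyVar (𝕜 := 𝕜) f n ∈ (G.grading.part (i + j)).baseChange 𝕜[X] := by
    intro f hf n
    cases n with
    | zero =>
      rw [polyVar, Finsupp.lmapDomain_apply, Finsupp.mapDomain_of_notMem_range _ _ (by simp)]
      exact Submodule.zero_mem _
    | succ n =>
      rw [polyVar, Finsupp.lmapDomain_apply, Finsupp.mapDomain_apply Nat.succ_injective]
      exact hf n
  have hconst : ∀ x ∈ (G.grading.part (i + j)).baseChange 𝕜[X], ∀ n,
      polyConst (𝕜 := 𝕜) x n ∈ (G.grading.part (i + j)).baseChange 𝕜[X] := by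
    intro x hx n
    rw [polyConst, Finsupp.lsingle_apply, Finsupp.single_apply]
    split_ifs
    exacts [hx, Submodule.zero_mem _]
  revert n
  refine baseChange_induction (G.grading.part i) (p := fun a =>
    ∀ n, G.quadraticBracket a b n ∈ (G.grading.part (i + j)).baseChange 𝕜[X]) ?_ ?_ ?_ ?_ ha
  · intro u hu
    refine baseChange_induction (G.grading.part j) (p := fun b =>
      ∀ n, G.quadraticBracket ((1 : 𝕜[X]) ⊗ₜ u) b n ∈ (G.grading.part (i + j)).baseChange 𝕜[X]) ?_ ?_ ?_ ?_ hb
    · intro v hv n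
      have h2 : G.novOp u v ∈ G.grading.part (i + j) := by
        rw [G.novOp_apply hu hv, add_comm]
        exact zsmul_mem (G.nov_mem hv hu) _
      rw [quadraticBracket_one]
      refine Submodule.add_mem _ (Submodule.add_mem _ (hconst _ ?_ n) (hconst _ ?_ n))
        (hvar _ (hconst _ ?_) n)
      · exact Submodule.tmul_mem_baseChange_of_mem _ (G.lie_mem hu hv)
      · exact Submodule.smul_mem _ _ (Submodule.tmul_mem_baseChange_of_mem _ h2)
      · exact Submodule.tmul_mem_baseChange_of_mem _ (Submodule.add_mem _ (G.nov_mem hu hv) h2)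
    · intro x y hx hy n
      rw [map_add]
      exact Submodule.add_mem _ (hx n) (hy n)
    · intro c x hx n
      rw [map_smul, Finsupp.smul_apply, ← algebraMap_smul 𝕜[X]]
      exact Submodule.smul_mem _ _ (hx n)
    · intro x hx n
      rw [quadraticBracket, sesquiExt_del_right]
      exact Submodule.add_mem _ (Submodule.smul_mem _ _ (hx n)) (hvar _ hx n)
  · intro x y hx hy n
    rw [map_add]
    exact Submodule.add_mem _ (hx n) (hy n)
  · intro c x hx n
    rw [map_smul, LinearMap.smul_apply, Finsupp.smul_apply, ← algebraMap_smul 𝕜[X]]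
    exact Submodule.smul_mem _ _ (hx n)
  · intro x hx n
    rw [quadraticBracket, sesquiExt_del_left]
    exact Submodule.neg_mem _ (hvar _ hx n)

theorem skew_del_aux {N : Type*} [AddCommGroup N] [Module 𝕜 N] (D A : Module.End 𝕜 N) (s : ℤ)
    (x : N) : (D + A) (-(s • x)) = -(s • -((-D - A : Module.End 𝕜 N) x)) := by
  simp only [map_neg, map_zsmul, LinearMap.add_apply, LinearMap.sub_apply, LinearMap.neg_apply]
  module

theorem skew_del_aux' {N : Type*} [AddCommGroup N] [Module 𝕜 N] (D A : Module.End 𝕜 N) (s : ℤ)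
    (x : N) : -A (-(s • x)) = -(s • (D x + (-D - A : Module.End 𝕜 N) x)) := by
  simp only [map_neg, map_zsmul, LinearMap.sub_apply, LinearMap.neg_apply]
  module

theorem skew_one_aux {N : Type*} [AddCommGroup N] [Module 𝕜 N] (D A : Module.End 𝕜 N)
    (κ : V →ₗ[𝕜] N) {i j : ZMod 2} {u v : V} (hu : u ∈ G.grading.part i)
    (hv : v ∈ G.grading.part j) :
    κ (G.lie u v) + D (κ (G.novOp u v)) + A (κ (G.nov u v + G.novOp u v)) =
      -(superSign i j • (κ (G.lie v u) + D (κ (G.novOp v u))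
        + (-D - A : Module.End 𝕜 N) (κ (G.nov v u + G.novOp v u)))) := by
  rw [G.novOp_apply hu hv, G.novOp_apply hv hu, G.lie_skew hu hv, superSign_comm j i]
  simp only [map_add, map_neg, map_zsmul, LinearMap.sub_apply, LinearMap.neg_apply]
  rcases superSign_eq i j with h | h <;> rw [h] <;> module

section

variable {L : Type*} [AddCommGroup L] [Module 𝕜 L] [Module 𝕜[X] L] [IsScalarTower 𝕜 𝕜[X] L]

/-- The right side `-s [b_{-∂-λ} a]` of the skew-symmetry identity. -/
noncomputable def skewRight (bracket : L →ₗ[𝕜] L →ₗ[𝕜] (ℕ →₀ L)) (s : ℤ) (a b : L) : ℕ →₀ L :=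
  -(s • polySubst (-polyMap del - polyVar : Module.End 𝕜 (ℕ →₀ L)) polyConst (bracket b a))

variable {bracket : L →ₗ[𝕜] L →ₗ[𝕜] (ℕ →₀ L)}

theorem skewRight_del_right
    (bl : ∀ a b, bracket (del (𝕜 := 𝕜) a) b = -polyVar (𝕜 := 𝕜) (bracket a b))
    (s : ℤ) (a b : L) : skewRight bracket s a (del (𝕜 := 𝕜) b) =
      (polyMap del + polyVar : Module.End 𝕜 (ℕ →₀ L)) (skewRight bracket s a b) := by
  rw [skewRight, bl, map_neg, polySubst_var, skewRight]
  exact (skew_del_aux _ _ _ _).symm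

theorem skewRight_del_left
    (br : ∀ a b, bracket a (del (𝕜 := 𝕜) b) =
      (polyMap del + polyVar : Module.End 𝕜 (ℕ →₀ L)) (bracket a b))
    (s : ℤ) (a b : L) : skewRight bracket s (del (𝕜 := 𝕜) a) b =
      -polyVar (𝕜 := 𝕜) (skewRight bracket s a b) := by
  have hc : Commute (polyMap del : Module.End 𝕜 (ℕ →₀ L)) (-polyMap del - polyVar) :=
    (Commute.refl (polyMap del : Module.End 𝕜 (ℕ →₀ L))).neg_right.sub_right
      (commute_polyMap_polyVar _)
  have hcomp : (polyConst ∘ₗ del : L →ₗ[𝕜] (ℕ →₀ L)) =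
      polyMap del ∘ₗ polyConst := LinearMap.ext fun x => (polyMap_const _ x).symm
  rw [skewRight, br, LinearMap.add_apply, map_add, polySubst_var, polySubst_map, hcomp,
    polySubst_comm _ _ hc, skewRight]
  exact (skew_del_aux' _ _ _ _).symm

theorem skewRight_add_left (s : ℤ) (a a' b : L) :
    skewRight bracket s (a + a') b = skewRight bracket s a b + skewRight bracket s a' b := by
  simp only [skewRight, map_add, smul_add]
  abel

theorem skewRight_add_right (s : ℤ) (a b b' : L) :
    skewRight bracket s a (b + b') = skewRight bracket s a b + skewRight bracket s a b' := by
  simp only [skewRight, map_add, LinearMap.add_apply, smul_add]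
  abel

theorem skewRight_smul_left (s : ℤ) (c : 𝕜) (a b : L) :
    skewRight bracket s (c • a) b = c • skewRight bracket s a b := by
  simp only [skewRight, map_smul]
  module

theorem skewRight_smul_right (s : ℤ) (c : 𝕜) (a b : L) :
    skewRight bracket s a (c • b) = c • skewRight bracket s a b := by
  simp only [skewRight, map_smul, LinearMap.smul_apply]
  module

theorem skewRight_one (ι : V →ₗ[𝕜] L)
    (hι : ∀ u v, bracket (ι u) (ι v) = polyConst (𝕜 := 𝕜) (ι (G.lie u v))
      + polyConst (𝕜 := 𝕜) (del (𝕜 := 𝕜) (ι (G.novOp u v)))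
      + polyVar (𝕜 := 𝕜) (polyConst (𝕜 := 𝕜) (ι (G.nov u v + G.novOp u v))))
    {i j : ZMod 2} {u v : V} (hu : u ∈ G.grading.part i) (hv : v ∈ G.grading.part j) :
    bracket (ι u) (ι v) = skewRight bracket (superSign i j) (ι u) (ι v) := by
  rw [skewRight, hι, hι]
  simp only [map_add (polySubst _ _), polySubst_const, polySubst_var]
  rw [← polyMap_const del, ← polyMap_const del]
  exact G.skew_one_aux (polyMap del) polyVar (polyConst ∘ₗ ι) hu hv

end

theorem quadraticBracket_skew {i j : ZMod 2} {a b : 𝕜[X] ⊗[𝕜] V}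
    (ha : a ∈ (G.grading.part i).baseChange 𝕜[X])
    (hb : b ∈ (G.grading.part j).baseChange 𝕜[X]) :
    G.quadraticBracket a b = skewRight G.quadraticBracket (superSign i j) a b := by
  have bl : ∀ a b, G.quadraticBracket (del (𝕜 := 𝕜) a) b =
    -polyVar (𝕜 := 𝕜) (G.quadraticBracket a b) := sesquiExt_del_left _
  have br : ∀ a b, G.quadraticBracket a (del (𝕜 := 𝕜) b) =
    (polyMap del + polyVar : Module.End 𝕜 (ℕ →₀ 𝕜[X] ⊗[𝕜] V)) (G.quadraticBracket a b) :=
    sesquiExt_del_right _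
  refine baseChange_induction (G.grading.part i) (p := fun a =>
    G.quadraticBracket a b = skewRight G.quadraticBracket (superSign i j) a b) ?_ ?_ ?_ ?_ ha
  · intro u hu
    refine baseChange_induction (G.grading.part j) (p := fun b =>
      G.quadraticBracket ((1 : 𝕜[X]) ⊗ₜ u) b =
        skewRight G.quadraticBracket (superSign i j) ((1 : 𝕜[X]) ⊗ₜ u) b) ?_ ?_ ?_ ?_ hb
    · intro v hv
      exact G.skewRight_one (TensorProduct.mk 𝕜 𝕜[X] V 1) G.quadraticBracket_one hu hv
    · intro x y hx hy
      rw [map_add, hx, hy, skewRight_add_right]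
    · intro c x hx
      rw [map_smul, hx, skewRight_smul_right]
    · intro x hx
      rw [br, hx, skewRight_del_right bl]
  · intro x y hx hy
    rw [map_add, LinearMap.add_apply, hx, hy, skewRight_add_left]
  · intro c x hx
    rw [map_smul, LinearMap.smul_apply, hx, skewRight_smul_left]
  · intro x hx
    rw [bl, hx, skewRight_del_left br]

set_option maxHeartbeats 2000000 in
theorem jacobi_aux {N : Type*} [AddCommGroup N] [Module 𝕜 N] (D A B : Module.End 𝕜 N)
    (cA : Commute A D) (cB : Commute B D) (cAB : Commute A B) (κ : V →ₗ[𝕜] N)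
    (F : Module.End 𝕜 N → V → V → N)
    (hF : ∀ T u v, F T u v = κ (G.lie u v) + D (κ (G.novOp u v)) + T (κ (G.nov u v + G.novOp u v)))
    {i j k : ZMod 2} {u v w : V}
    (hu : u ∈ G.grading.part i) (hv : v ∈ G.grading.part j) (hw : w ∈ G.grading.part k) :
    F A u (G.lie v w) + (D (F A u (G.novOp v w)) + A (F A u (G.novOp v w)))
        + B (F A u (G.nov v w + G.novOp v w))
      - superSign i j • (F B v (G.lie u w) + (D (F B v (G.novOp u w)) + B (F B v (G.novOp u w)))
        + A (F B v (G.nov u w + G.novOp u w))) =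
    F (A + B) (G.lie u v) w + -(A + B) (F (A + B) (G.novOp u v) w)
      + A (F (A + B) (G.nov u v + G.novOp u v) w) := by
  have lu := G.left_symm u hv hw
  have lv := G.left_symm v hu hw
  have lw := G.left_symm w hu hv
  have ru := G.right_comm u hv hw
  have rv := G.right_comm v hu hw
  have rw' := G.right_comm w hu hv
  have sa := G.lie_skew hu hv
  have sb := G.lie_skew hu hw
  have sc := G.lie_skew hv hw
  have j0 := G.lie_jacobi w hu hv
  have c1 := G.compat hu hw hv
  have c2 := G.compat hv hu hw
  have c3 := G.compat hu hv hw
  have s1 := G.lie_skew (G.nov_mem hu hv) hw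
  have s2 := G.lie_skew (G.nov_mem hv hu) hw
  have o1 := G.novOp_apply hu (G.lie_mem hv hw)
  have o2 := G.novOp_apply hu (G.nov_mem hw hv)
  have o3 := G.novOp_apply hu (G.nov_mem hv hw)
  have o4 := G.novOp_apply hv (G.lie_mem hu hw)
  have o5 := G.novOp_apply hv (G.nov_mem hw hu)
  have o6 := G.novOp_apply hv (G.nov_mem hu hw)
  have o7 := G.novOp_apply (G.lie_mem hu hv) hw
  have o8 := G.novOp_apply (G.nov_mem hu hv) hw
  have o9 := G.novOp_apply (G.nov_mem hv hu) hw
  have o10 := G.novOp_apply hu hv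
  have o11 := G.novOp_apply hu hw
  have o12 := G.novOp_apply hv hw
  simp only [superSign_add_left, superSign_add_right, superSign_comm j i,
    superSign_comm k j] at *
  have e1 := superSign_eq i j
  have e2 := superSign_eq i k
  have e3 := superSign_eq j k
  generalize superSign i j = a at *
  generalize superSign i k = b at *
  generalize superSign j k = c at *
  -- the coefficients of the monomials in `∂`, `λ`, `μ`
  have hD : (a * b) • G.nov (G.lie v w) u + c • G.lie u (G.nov w v) - c • G.nov (G.lie u w) v
      - (a * b) • G.lie v (G.nov w u) - (b * c) • G.nov w (G.lie u v) = 0 := by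
    rcases e1 with rfl | rfl <;> rcases e2 with rfl | rfl <;> rcases e3 with rfl | rfl <;>
    rw [c1] <;> module
  have sa' := congrArg (fun x => G.nov x w) sa
  have sb' := congrArg (fun x => G.nov x v) sb
  have sc' := congrArg (fun x => G.nov x u) sc
  simp only [map_neg, map_zsmul, LinearMap.neg_apply, LinearMap.smul_apply] at sa' sb' sc'
  have hA : G.nov u (G.lie v w) + (a * b) • G.nov (G.lie v w) u + c • G.lie u (G.nov w v)
      - a • G.lie v (G.nov u w) - (a * b) • G.lie v (G.nov w u) - G.nov (G.lie u v) w
      - (b * c) • G.nov w (G.lie u v) - G.lie (G.nov u v) w = 0 := by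
    rcases e1 with h1 | h1 <;> rcases e2 with h2 | h2 <;> rcases e3 with h3 | h3 <;>
    linear_combination (norm := (simp only [h1, h2, h3]; module)) hD + c2 - sa' + c • sb' - s1
  have hB : G.lie u (G.nov v w) + c • G.lie u (G.nov w v) - a • G.nov v (G.lie u w)
      - c • G.nov (G.lie u w) v - (a * b) • G.lie v (G.nov w u) - G.nov (G.lie u v) w
      - (b * c) • G.nov w (G.lie u v) + a • G.lie (G.nov v u) w = 0 := by
    rcases e1 with h1 | h1 <;> rcases e2 with h2 | h2 <;> rcases e3 with h3 | h3 <;>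
    linear_combination (norm := (simp only [h1, h2, h3]; module)) hD - a • c3 - (a * b) • sc' + a • s2
  have hDD : (a * b * c) • G.nov (G.nov w v) u - (b * c) • G.nov (G.nov w u) v = 0 := by
    rcases e1 with h1 | h1 <;> rcases e2 with h2 | h2 <;> rcases e3 with h3 | h3 <;>
    linear_combination (norm := (simp only [h1, h2, h3]; module)) (-(b * c)) • rw'
  have hDA : c • G.nov u (G.nov w v) + (2 * (a * b * c)) • G.nov (G.nov w v) u
      - c • G.nov (G.nov u w) v - (b * c) • G.nov (G.nov w u) v
      - (b * c) • G.nov w (G.nov u v) = 0 := by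
    rcases e1 with h1 | h1 <;> rcases e2 with h2 | h2 <;> rcases e3 with h3 | h3 <;>
    linear_combination (norm := (simp only [h1, h2, h3]; module)) (-c) • lv - (2 * (b * c)) • rw'
  have hDB : (a * b) • G.nov (G.nov v w) u + (a * b * c) • G.nov (G.nov w v) u
      - (a * b) • G.nov v (G.nov w u) - (2 * (b * c)) • G.nov (G.nov w u) v
      + (a * b * c) • G.nov w (G.nov v u) = 0 := by
    rcases e1 with h1 | h1 <;> rcases e2 with h2 | h2 <;> rcases e3 with h3 | h3 <;>
    linear_combination (norm := (simp only [h1, h2, h3]; module)) (a * b) • lu - (2 * (b * c)) • rw'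
  have hAA : c • G.nov u (G.nov w v) + (a * b * c) • G.nov (G.nov w v) u - G.nov (G.nov u v) w
      - (b * c) • G.nov w (G.nov u v) = 0 := by
    rcases e1 with h1 | h1 <;> rcases e2 with h2 | h2 <;> rcases e3 with h3 | h3 <;>
    linear_combination (norm := (simp only [h1, h2, h3]; module)) (-c) • lv - ru - (b * c) • rw'
  have hBB : -(a * b) • G.nov v (G.nov w u) - (b * c) • G.nov (G.nov w u) v + a • G.nov (G.nov v u) w
      + (a * b * c) • G.nov w (G.nov v u) = 0 := by
    rcases e1 with h1 | h1 <;> rcases e2 with h2 | h2 <;> rcases e3 with h3 | h3 <;>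
    linear_combination (norm := (simp only [h1, h2, h3]; module)) a • rv + (a * b) • lu - (b * c) • rw'
  have hM : G.nov u (G.nov v w) + c • G.nov u (G.nov w v) + (a * b) • G.nov (G.nov v w) u
      + (a * b * c) • G.nov (G.nov w v) u - a • G.nov v (G.nov u w)
      - (a * b) • G.nov v (G.nov w u) - c • G.nov (G.nov u w) v - (b * c) • G.nov (G.nov w u) v
      + a • G.nov (G.nov v u) w + (a * b * c) • G.nov w (G.nov v u) - G.nov (G.nov u v) w
      - (b * c) • G.nov w (G.nov u v) = 0 := by
    rcases e1 with h1 | h1 <;> rcases e2 with h2 | h2 <;> rcases e3 with h3 | h3 <;>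
    linear_combination (norm := (simp only [h1, h2, h3]; module)) -lw - c • lv + (a * b) • lu - (2 * (b * c)) • rw'
  have k1 := congrArg κ j0
  have kD := congrArg (fun x => D (κ x)) hD
  have kA := congrArg (fun x => A (κ x)) hA
  have kB := congrArg (fun x => B (κ x)) hB
  have kDD := congrArg (fun x => D (D (κ x))) hDD
  have kDA := congrArg (fun x => D (A (κ x))) hDA
  have kDB := congrArg (fun x => D (B (κ x))) hDB
  have kAA := congrArg (fun x => A (A (κ x))) hAA
  have kBB := congrArg (fun x => B (B (κ x))) hBB
  have kM := congrArg (fun x => A (B (κ x))) hM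
  have q1 : ∀ x, A (D x) = D (A x) := fun x => LinearMap.congr_fun cA.eq x
  have q2 : ∀ x, B (D x) = D (B x) := fun x => LinearMap.congr_fun cB.eq x
  have q3 : ∀ x, B (A x) = A (B x) := fun x => (LinearMap.congr_fun cAB.eq x).symm
  clear hD hA hB hDD hDA hDB hAA hBB hM sa sb sc sa' sb' sc' s1 s2 c1 c2 c3 lu lv lw ru rv rw' j0
  simp only [hF, map_add, map_sub, map_neg, map_zsmul, map_zero, LinearMap.add_apply,
    LinearMap.neg_apply, LinearMap.smul_apply, o1, o2, o3, o4, o5, o6, o7, o8, o9, o10, o11, o12,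
    q1, q2, q3] at *
  clear o1 o2 o3 o4 o5 o6 o7 o8 o9 o10 o11 o12
  rcases e1 with rfl | rfl <;> rcases e2 with rfl | rfl <;> rcases e3 with rfl | rfl <;>
  linear_combination (norm := module) k1 + kD + kA + kB + kDD + kDA + kDB + kAA + kBB + kM

section

variable {L : Type*} [AddCommGroup L] [Module 𝕜 L] [Module 𝕜[X] L] [IsScalarTower 𝕜 𝕜[X] L]
  {bracket : L →ₗ[𝕜] L →ₗ[𝕜] (ℕ →₀ L)}

theorem jacobi_one (bl : ∀ a b, bracket (del (𝕜 := 𝕜) a) b = -polyVar (𝕜 := 𝕜) (bracket a b))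
    (br : ∀ a b, bracket a (del (𝕜 := 𝕜) b) =
      (polyMap del + polyVar : Module.End 𝕜 (ℕ →₀ L)) (bracket a b))
    (ι : V →ₗ[𝕜] L)
    (hι : ∀ u v, bracket (ι u) (ι v) = polyConst (𝕜 := 𝕜) (ι (G.lie u v))
      + polyConst (𝕜 := 𝕜) (del (𝕜 := 𝕜) (ι (G.novOp u v)))
      + polyVar (𝕜 := 𝕜) (polyConst (𝕜 := 𝕜) (ι (G.nov u v + G.novOp u v))))
    {i j k : ZMod 2} {u v w : V} (hu : u ∈ G.grading.part i) (hv : v ∈ G.grading.part j)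
    (hw : w ∈ G.grading.part k) :
    jacobiLeft bracket (superSign i j) (ι u) (ι v) (ι w) =
      jacobiRight bracket bracket (ι u) (ι v) (ι w) := by
  have h := G.jacobi_aux (polyDel₂ : Module.End 𝕜 (ℕ →₀ ℕ →₀ L)) polyLam polyMu
    commute_polyLam_polyDel₂ commute_polyMu_polyDel₂ commute_polyLam_polyMu (polyConst₂ ∘ₗ ι)
    (fun T u v => evalOp bracket T (ι u) (ι v)) (fun T u v => by
      simp only [evalOp, LinearMap.compr₂_apply, hι, map_add (polySubst _ _), polySubst_const,
        polySubst_var, polyDel₂_const₂, LinearMap.comp_apply]) hu hv hw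
  rw [jacobiLeft, jacobiRight, hι, hι, hι]
  simp only [map_add (polySubst _ _), polySubst_const, polySubst_var, LinearMap.flip_apply,
    evalOp_del_left bl, evalOp_del_right br _ commute_polyLam_polyDel₂,
    evalOp_del_right br _ commute_polyMu_polyDel₂]
  exact h

end

theorem quadraticBracket_jacobi {i j : ZMod 2} {a b : 𝕜[X] ⊗[𝕜] V} (c : 𝕜[X] ⊗[𝕜] V)
    (ha : a ∈ (G.grading.part i).baseChange 𝕜[X])
    (hb : b ∈ (G.grading.part j).baseChange 𝕜[X]) :
    jacobiLeft G.quadraticBracket (superSign i j) a b c =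
      jacobiRight G.quadraticBracket G.quadraticBracket a b c := by
  have bl : ∀ a b, G.quadraticBracket (del (𝕜 := 𝕜) a) b =
    -polyVar (𝕜 := 𝕜) (G.quadraticBracket a b) := sesquiExt_del_left _
  have br : ∀ a b, G.quadraticBracket a (del (𝕜 := 𝕜) b) =
    (polyMap del + polyVar : Module.End 𝕜 (ℕ →₀ 𝕜[X] ⊗[𝕜] V)) (G.quadraticBracket a b) :=
    sesquiExt_del_right _
  have hc : c ∈ (⊤ : Submodule 𝕜 V).baseChange 𝕜[X] := by simp
  refine baseChange_induction (G.grading.part i) (p := fun a =>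
    jacobiLeft G.quadraticBracket (superSign i j) a b c =
      jacobiRight G.quadraticBracket G.quadraticBracket a b c) ?_ ?_ ?_ ?_ ha
  · intro u hu
    refine baseChange_induction (G.grading.part j) (p := fun b =>
      jacobiLeft G.quadraticBracket (superSign i j) ((1 : 𝕜[X]) ⊗ₜ u) b c =
        jacobiRight G.quadraticBracket G.quadraticBracket ((1 : 𝕜[X]) ⊗ₜ u) b c) ?_ ?_ ?_ ?_ hb
    · intro v hv
      refine baseChange_induction ⊤ (p := fun c =>
        jacobiLeft G.quadraticBracket (superSign i j) ((1 : 𝕜[X]) ⊗ₜ u) ((1 : 𝕜[X]) ⊗ₜ v) c =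
          jacobiRight G.quadraticBracket G.quadraticBracket
            ((1 : 𝕜[X]) ⊗ₜ u) ((1 : 𝕜[X]) ⊗ₜ v) c) ?_ ?_ ?_ ?_ hc
      · intro w _
        have hw : w ∈ ⨆ k, G.grading.part k := by
          rw [G.grading.isInternal.submodule_iSup_eq_top]; trivial
        refine Submodule.iSup_induction G.grading.part (motive := fun w =>
          jacobiLeft G.quadraticBracket (superSign i j) ((1 : 𝕜[X]) ⊗ₜ u) ((1 : 𝕜[X]) ⊗ₜ v)
              ((1 : 𝕜[X]) ⊗ₜ w) =
            jacobiRight G.quadraticBracket G.quadraticBracket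
              ((1 : 𝕜[X]) ⊗ₜ u) ((1 : 𝕜[X]) ⊗ₜ v) ((1 : 𝕜[X]) ⊗ₜ w)) hw ?_ ?_ ?_
        · intro k w hw
          exact G.jacobi_one bl br (TensorProduct.mk 𝕜 𝕜[X] V 1) G.quadraticBracket_one hu hv hw
        · rw [tmul_zero, ← zero_smul 𝕜 (0 : 𝕜[X] ⊗[𝕜] V), jacobiLeft_smul_right,
            jacobiRight_smul_right, zero_smul, zero_smul]
        · intro x y hx hy
          rw [tmul_add, jacobiLeft_add_right, jacobiRight_add_right, hx, hy]
      · intro x y hx hy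
        rw [jacobiLeft_add_right, jacobiRight_add_right, hx, hy]
      · intro r x hx
        rw [jacobiLeft_smul_right, jacobiRight_smul_right, hx]
      · intro x hx
        rw [jacobiLeft_del_right br, jacobiRight_del_right br, hx]
    · intro x y hx hy
      rw [jacobiLeft_add_mid, jacobiRight_add_mid, hx, hy]
    · intro r x hx
      rw [jacobiLeft_smul_mid, jacobiRight_smul_mid, hx]
    · intro x hx
      rw [jacobiLeft_del_mid bl, jacobiRight_del_mid bl br, hx]
  · intro x y hx hy
    rw [jacobiLeft_add_left, jacobiRight_add_left, hx, hy]
  · intro r x hx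
    rw [jacobiLeft_smul_left, jacobiRight_smul_left, hx]
  · intro x hx
    rw [jacobiLeft_del_left bl, jacobiRight_del_left bl, hx]

/-- The quadratic Lie conformal superalgebra `L(V) = H ⊗ V` of a GD-superalgebra `V`, with
`[a_λ b] = [a, b] + ∂ ((-1)^{|a||b|} b ∘ a) + λ (a ∘ b + (-1)^{|a||b|} b ∘ a)`
for homogeneous `a, b ∈ V`. -/
noncomputable def quadratic : LieConformalSuperalgebra 𝕜 (𝕜[X] ⊗[𝕜] V) where
  grading := G.grading.baseChange 𝕜[X]
  bracket := G.quadraticBracket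
  bracket_mem := G.quadraticBracket_mem
  bracket_del_left := sesquiExt_del_left _
  bracket_del_right := sesquiExt_del_right _
  bracket_skew := G.quadraticBracket_skew
  jacobi := G.quadraticBracket_jacobi

end GDSuperalgebra

/-! If `V` sits in a differential Poisson superalgebra `P` with `a ∘ b = a d(b)`, the bracket of
generators of `L(V)` reads `{a, b} + ∂(d(a) b) + λ(a d(b) + d(a) b)`. The same formula with `b`
replaced by a vector `x` defines a conformal action of `L(V)` on `H ⊗ M` for every superspace `M` on
which operators `{a, ·}`, `a d(·)` and `d(a) ·` satisfy the expected identities. These identities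
are the axioms of `Rep`, and `Rep.jacobi_aux` shows that they suffice. If `M` is finite-dimensional,
`H ⊗ M` is finite over `H`, so it remains to find a finite-dimensional `M` with a faithful action.

For faithfulness it is enough to have a vector `e` from which `a d(e)` recovers `a`. Adjoin to `P` a
formal even `e` with `d(e) = 1` and `{P, e} = 0`. The space `P ⊕ (𝕜 ⊕ P) e` is closed under the
three operators (the summand `𝕜` is there because `P` need not have a unit) and `a d(e) = a`. It
need not be finite-dimensional, however: the orbit of `e` already contains all products `d(a₁) ⋯
d(aₙ) e`.

The remedy is to remember a coefficient `c + q` of `e` only through its right multiplication `φ : v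
↦ c v + v q`, when this maps `V` to `V`. The three operators change `φ` by formulas that involve
only the operations of `V`. So they act on the pairs `(x, φ) ∈ V ⊕ End(V)` that are represented by
vectors `x + (c + q) e`, and these pairs form a finite-dimensional space, the `hull`. The axioms of
`Rep` are computed in `P ⊕ (𝕜 ⊕ P) e` and descend to the hull, because a representing vector
determines its pair (`Lifts.unique`, from the injectivity of `τ`). The vector `e` represents `(0,
id)`, which makes the action faithful. -/

namespace GDSuperalgebra

/-! ### Representations of a GD-superalgebra -/

/-- A representation of a GD-superalgebra on a superspace `M`: the operators `lieAct a`, `novAct a`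
and `derAct a` play the role of `{a, ·}`, `a d(·)` and `d(a) ·` in a differential Poisson
superalgebra. -/
structure Rep {𝕜 V : Type*} [Field 𝕜] [AddCommGroup V] [Module 𝕜 V] (G : GDSuperalgebra 𝕜 V)
    (M : Type*) [AddCommGroup M] [Module 𝕜 M] where
  grading : SuperGrading 𝕜 M
  lieAct : V →ₗ[𝕜] M →ₗ[𝕜] M
  novAct : V →ₗ[𝕜] M →ₗ[𝕜] M
  derAct : V →ₗ[𝕜] M →ₗ[𝕜] M
  lieAct_mem : ∀ {i j : ZMod 2} {a : V} {x : M}, a ∈ G.grading.part i → x ∈ grading.part j →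
    lieAct a x ∈ grading.part (i + j)
  novAct_mem : ∀ {i j : ZMod 2} {a : V} {x : M}, a ∈ G.grading.part i → x ∈ grading.part j →
    novAct a x ∈ grading.part (i + j)
  derAct_mem : ∀ {i j : ZMod 2} {a : V} {x : M}, a ∈ G.grading.part i → x ∈ grading.part j →
    derAct a x ∈ grading.part (i + j)
  lieAct_lie : ∀ {i j : ZMod 2} {a b : V} (x : M), a ∈ G.grading.part i → b ∈ G.grading.part j →
    lieAct (G.lie a b) x = lieAct a (lieAct b x) - superSign i j • lieAct b (lieAct a x)
  derAct_comm : ∀ {i j : ZMod 2} {a b : V} (x : M), a ∈ G.grading.part i → b ∈ G.grading.part j →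
    derAct a (derAct b x) = superSign i j • derAct b (derAct a x)
  -- Here `d(a d(b)) = d(a) d(b) + a d²(b)`. Multiplication by `a d²(b)` is not one of the three
  -- operators, but it is the supercommutator of `a d(·)` with `d(b) ·`.
  derAct_nov : ∀ {i j : ZMod 2} {a b : V} (x : M), a ∈ G.grading.part i → b ∈ G.grading.part j →
    derAct (G.nov a b) x = novAct a (derAct b x) - superSign i j • derAct b (novAct a x)
      + derAct a (derAct b x)
  novAct_nov : ∀ {i j : ZMod 2} {a b : V} (x : M), a ∈ G.grading.part i → b ∈ G.grading.part j →
    novAct (G.nov a b) x = superSign i j • derAct b (novAct a x)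
  novAct_comm : ∀ {i j : ZMod 2} {a b : V} (x : M), a ∈ G.grading.part i → b ∈ G.grading.part j →
    novAct a (novAct b x) - superSign i j • novAct b (novAct a x) =
      novAct (G.nov a b) x - superSign i j • novAct (G.nov b a) x
  derAct_lie : ∀ {i j : ZMod 2} {a b : V} (x : M), a ∈ G.grading.part i → b ∈ G.grading.part j →
    derAct (G.lie a b) x = lieAct a (derAct b x) - superSign i j • derAct b (lieAct a x)
      + derAct a (lieAct b x) - superSign i j • lieAct b (derAct a x)
  -- Comes from expanding `{a d(b), x}` and `{b, a d(x)}` by the Leibniz rule and `d{b, x}` by the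
  -- derivation property. The terms `{a, b} d(x)` and `{a d(b), x}` appear together because neither
  -- of the two expansions isolates one of them.
  novAct_lie : ∀ {i j : ZMod 2} {a b : V} (x : M), a ∈ G.grading.part i → b ∈ G.grading.part j →
    novAct (G.lie a b) x + lieAct (G.nov a b) x = novAct a (lieAct b x)
      - superSign i j • lieAct b (novAct a x) + superSign i j • derAct b (lieAct a x)

end GDSuperalgebra

/-! ### From representations of `V` to conformal representations of `L(V)` -/

section

variable {𝕜 : Type*} {M : Type*} [Field 𝕜] [AddCommGroup M] [Module 𝕜 M] [Module 𝕜[X] M]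

theorem polyVar_mem {U : Submodule 𝕜[X] M} {f : ℕ →₀ M} (hf : ∀ n, f n ∈ U) (n : ℕ) :
    polyVar (𝕜 := 𝕜) f n ∈ U := by
  cases n with
  | zero =>
    rw [polyVar, Finsupp.lmapDomain_apply, Finsupp.mapDomain_of_notMem_range _ _ (by simp)]
    exact U.zero_mem
  | succ n =>
    rw [polyVar, Finsupp.lmapDomain_apply, Finsupp.mapDomain_apply Nat.succ_injective]
    exact hf n

theorem polyConst_mem {U : Submodule 𝕜[X] M} {x : M} (hx : x ∈ U) (n : ℕ) :
    polyConst (𝕜 := 𝕜) x n ∈ U := by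
  rw [polyConst, Finsupp.lsingle_apply, Finsupp.single_apply]
  split_ifs
  exacts [hx, U.zero_mem]

end

namespace GDSuperalgebra.Rep

variable {𝕜 V M : Type*} [Field 𝕜] [AddCommGroup V] [Module 𝕜 V] {G : GDSuperalgebra 𝕜 V}
  [AddCommGroup M] [Module 𝕜 M] (ρ : G.Rep M)

/-- The conformal action on generators:
`ρ_λ(a, x) = {a, x} + ∂ (d(a) x) + λ (a d(x) + d(a) x)`. -/
noncomputable def conformalAct₀ : V →ₗ[𝕜] M →ₗ[𝕜] (ℕ →₀ 𝕜[X] ⊗[𝕜] M) :=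
  let ι : M →ₗ[𝕜] 𝕜[X] ⊗[𝕜] M := TensorProduct.mk 𝕜 𝕜[X] M 1
  ρ.lieAct.compr₂ (polyConst ∘ₗ ι) + ρ.derAct.compr₂ (polyConst ∘ₗ del ∘ₗ ι)
    + (ρ.novAct + ρ.derAct).compr₂ (polyVar ∘ₗ polyConst ∘ₗ ι)

/-- The conformal action of `H ⊗ V` on `H ⊗ M`. -/
noncomputable def conformalAct :
    𝕜[X] ⊗[𝕜] V →ₗ[𝕜] 𝕜[X] ⊗[𝕜] M →ₗ[𝕜] (ℕ →₀ 𝕜[X] ⊗[𝕜] M) :=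
  sesquiExt ρ.conformalAct₀

theorem conformalAct_one (u : V) (x : M) :
    ρ.conformalAct ((1 : 𝕜[X]) ⊗ₜ u) ((1 : 𝕜[X]) ⊗ₜ x) =
      polyConst (𝕜 := 𝕜) ((1 : 𝕜[X]) ⊗ₜ[𝕜] ρ.lieAct u x)
        + polyConst (𝕜 := 𝕜) (del (𝕜 := 𝕜) ((1 : 𝕜[X]) ⊗ₜ[𝕜] ρ.derAct u x))
        + polyVar (𝕜 := 𝕜) (polyConst (𝕜 := 𝕜)
            ((1 : 𝕜[X]) ⊗ₜ[𝕜] (ρ.novAct u x + ρ.derAct u x))) := by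
  simp [conformalAct, sesquiExt_one, conformalAct₀]

theorem conformalAct_mem {i j : ZMod 2} {a : 𝕜[X] ⊗[𝕜] V} {b : 𝕜[X] ⊗[𝕜] M}
    (ha : a ∈ (G.grading.part i).baseChange 𝕜[X]) (hb : b ∈ (ρ.grading.part j).baseChange 𝕜[X])
    (n : ℕ) : ρ.conformalAct a b n ∈ (ρ.grading.part (i + j)).baseChange 𝕜[X] := by
  revert n
  refine baseChange_induction (G.grading.part i) (p := fun a =>
    ∀ n, ρ.conformalAct a b n ∈ (ρ.grading.part (i + j)).baseChange 𝕜[X]) ?_ ?_ ?_ ?_ ha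
  · intro u hu
    refine baseChange_induction (ρ.grading.part j) (p := fun b => ∀ n,
      ρ.conformalAct ((1 : 𝕜[X]) ⊗ₜ u) b n ∈ (ρ.grading.part (i + j)).baseChange 𝕜[X])
      ?_ ?_ ?_ ?_ hb
    · intro v hv n
      have h2 := ρ.derAct_mem hu hv
      rw [conformalAct_one]
      refine Submodule.add_mem _ (Submodule.add_mem _ (polyConst_mem ?_ n) (polyConst_mem ?_ n))
        (polyVar_mem (polyConst_mem ?_) n)
      · exact Submodule.tmul_mem_baseChange_of_mem _ (ρ.lieAct_mem hu hv)
      · exact Submodule.smul_mem _ _ (Submodule.tmul_mem_baseChange_of_mem _ h2)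
      · exact Submodule.tmul_mem_baseChange_of_mem _
          (Submodule.add_mem _ (ρ.novAct_mem hu hv) h2)
    · intro x y hx hy n
      rw [map_add]
      exact Submodule.add_mem _ (hx n) (hy n)
    · intro c x hx n
      rw [map_smul, Finsupp.smul_apply, ← algebraMap_smul 𝕜[X]]
      exact Submodule.smul_mem _ _ (hx n)
    · intro x hx n
      rw [conformalAct, sesquiExt_del_right]
      exact Submodule.add_mem _ (Submodule.smul_mem _ _ (hx n)) (polyVar_mem hx n)
  · intro x y hx hy n
    rw [map_add]
    exact Submodule.add_mem _ (hx n) (hy n)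
  · intro c x hx n
    rw [map_smul, LinearMap.smul_apply, Finsupp.smul_apply, ← algebraMap_smul 𝕜[X]]
    exact Submodule.smul_mem _ _ (hx n)
  · intro x hx n
    rw [conformalAct, sesquiExt_del_left]
    exact Submodule.neg_mem _ (polyVar_mem hx n)

set_option maxHeartbeats 1000000 in
-- The Jacobi identity on generators, with commuting operators `D`, `A`, `B` in the roles of `∂`,
-- `λ`, `μ`, compared monomial by monomial. The coefficient of `1` is `lieAct_lie`, that of `D` is
-- `derAct_lie`. Those of `A` and `B` combine `derAct_lie` with `novAct_lie`, and those of `A²` and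
-- `B²` combine `derAct_nov` with `novAct_nov`. The coefficients of `D²`, `DA`, `DB` need
-- `derAct_comm`, and that of `AB` needs `novAct_comm`.
theorem jacobi_aux {N : Type*} [AddCommGroup N] [Module 𝕜 N] (D A B : Module.End 𝕜 N)
    (cA : Commute A D) (cB : Commute B D) (cAB : Commute A B) (κ : M →ₗ[𝕜] N)
    (F : Module.End 𝕜 N → V → M → N)
    (hF : ∀ T u x, F T u x = κ (ρ.lieAct u x) + D (κ (ρ.derAct u x))
      + T (κ (ρ.novAct u x + ρ.derAct u x)))
    {i j : ZMod 2} {u v : V} (hu : u ∈ G.grading.part i) (hv : v ∈ G.grading.part j) (w : M) :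
    F A u (ρ.lieAct v w) + (D (F A u (ρ.derAct v w)) + A (F A u (ρ.derAct v w)))
        + B (F A u (ρ.novAct v w + ρ.derAct v w))
      - superSign i j • (F B v (ρ.lieAct u w) + (D (F B v (ρ.derAct u w)) + B (F B v (ρ.derAct u w)))
        + A (F B v (ρ.novAct u w + ρ.derAct u w))) =
    F (A + B) (G.lie u v) w + -(A + B) (F (A + B) (G.novOp u v) w)
      + A (F (A + B) (G.nov u v + G.novOp u v) w) := by
  have h1 := ρ.lieAct_lie w hu hv
  have h2 := ρ.derAct_comm w hu hv
  have h3 := ρ.derAct_nov w hu hv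
  have h3' := ρ.derAct_nov w hv hu
  have h4 := ρ.novAct_nov w hu hv
  have h4' := ρ.novAct_nov w hv hu
  have h5 := ρ.novAct_comm w hu hv
  have h6 := ρ.derAct_lie w hu hv
  have h7 := ρ.novAct_lie w hu hv
  have h7' := ρ.novAct_lie w hv hu
  -- The axiom `novAct_lie` is used for `(u, v)` and for `(v, u)`; this expresses both through
  -- `G.lie u v`.
  have h8 : ρ.novAct (G.lie v u) w = -(superSign i j • ρ.novAct (G.lie u v) w) := by
    rw [G.lie_skew hv hu, superSign_comm j i]; simp
  have q1 : ∀ x, A (D x) = D (A x) := fun x => LinearMap.congr_fun cA.eq x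
  have q2 : ∀ x, B (D x) = D (B x) := fun x => LinearMap.congr_fun cB.eq x
  have q3 : ∀ x, B (A x) = A (B x) := fun x => (LinearMap.congr_fun cAB.eq x).symm
  rw [superSign_comm j i] at h3' h4' h7'
  rw [h8] at h7'
  rw [h4, h4'] at h5
  -- Solved for the action of `G.nov u v` and `G.nov v u` by `lieAct`, so that `novAct_lie` can
  -- serve as a rewriting rule.
  have h7a := eq_sub_of_add_eq' h7
  have h7b := eq_sub_of_add_eq' h7'
  rw [G.novOp_apply hu hv]
  simp only [hF, map_add, map_sub, map_neg, map_zsmul, LinearMap.add_apply,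
    LinearMap.smul_apply, q1, q2, q3, h1, h3, h3', h4, h4', h6, h7a, h7b]
  -- The axioms that are not used as rewriting rules, each placed at the monomial where it is
  -- needed.
  have k2 := congrArg (fun x => D (D (κ x))) h2
  have k2a := congrArg (fun x => D (A (κ x))) h2
  have k2b := congrArg (fun x => D (B (κ x))) h2
  have k5 := congrArg (fun x => A (B (κ x))) h5
  simp only [map_sub, map_zsmul] at k2 k2a k2b k5
  clear h1 h2 h3 h3' h4 h4' h5 h6 h7 h7' h7a h7b h8 hF
  rcases superSign_eq i j with e | e <;> simp only [e] at * <;>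
  linear_combination (norm := module) k2 + k2a + k2b + k5

theorem conformalAct_del_left (a : 𝕜[X] ⊗[𝕜] V) (x : 𝕜[X] ⊗[𝕜] M) :
    ρ.conformalAct (del (𝕜 := 𝕜) a) x = -polyVar (𝕜 := 𝕜) (ρ.conformalAct a x) :=
  sesquiExt_del_left _ _ _

theorem conformalAct_del_right (a : 𝕜[X] ⊗[𝕜] V) (x : 𝕜[X] ⊗[𝕜] M) :
    ρ.conformalAct a (del (𝕜 := 𝕜) x) =
      (polyMap del + polyVar : Module.End 𝕜 (ℕ →₀ 𝕜[X] ⊗[𝕜] M)) (ρ.conformalAct a x) :=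
  sesquiExt_del_right _ _ _

/-- The case of `jacobi_aux` where `D`, `A`, `B` are the multiplications by `∂`, `λ`, `μ` on `(H ⊗
M)[λ, μ]`, and `F T u x` is `(u_T x)`. -/
theorem jacobi_one {i j : ZMod 2} {u v : V} (hu : u ∈ G.grading.part i)
    (hv : v ∈ G.grading.part j) (w : M) :
    jacobiLeft ρ.conformalAct (superSign i j) ((1 : 𝕜[X]) ⊗ₜ u) ((1 : 𝕜[X]) ⊗ₜ v)
        ((1 : 𝕜[X]) ⊗ₜ w) =
      jacobiRight G.quadraticBracket ρ.conformalAct ((1 : 𝕜[X]) ⊗ₜ u) ((1 : 𝕜[X]) ⊗ₜ v)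
        ((1 : 𝕜[X]) ⊗ₜ w) := by
  have h := ρ.jacobi_aux (polyDel₂ : Module.End 𝕜 (ℕ →₀ ℕ →₀ 𝕜[X] ⊗[𝕜] M)) polyLam polyMu
    commute_polyLam_polyDel₂ commute_polyMu_polyDel₂ commute_polyLam_polyMu
    (polyConst₂ ∘ₗ TensorProduct.mk 𝕜 𝕜[X] M 1)
    (fun T u x => evalOp ρ.conformalAct T ((1 : 𝕜[X]) ⊗ₜ u) ((1 : 𝕜[X]) ⊗ₜ x)) (fun T u x => by
      simp only [evalOp, LinearMap.compr₂_apply, conformalAct_one, map_add (polySubst _ _),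
        polySubst_const, polySubst_var, polyDel₂_const₂, LinearMap.comp_apply,
        TensorProduct.mk_apply]) hu hv w
  rw [jacobiLeft, jacobiRight, conformalAct_one, conformalAct_one, quadraticBracket_one]
  simp only [map_add (polySubst _ _), polySubst_const, polySubst_var, LinearMap.flip_apply,
    evalOp_del_left ρ.conformalAct_del_left,
    evalOp_del_right ρ.conformalAct_del_right _ commute_polyLam_polyDel₂,
    evalOp_del_right ρ.conformalAct_del_right _ commute_polyMu_polyDel₂]
  exact h

/-- Both sides respond in the same way to `∂` in each of the three arguments, so generators suffice.
The module argument runs over all of `M`, since the axioms of `Rep` do not require `x` to be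
homogeneous. -/
theorem conformalAct_jacobi {i j : ZMod 2} {a b : 𝕜[X] ⊗[𝕜] V} (x : 𝕜[X] ⊗[𝕜] M)
    (ha : a ∈ (G.grading.part i).baseChange 𝕜[X])
    (hb : b ∈ (G.grading.part j).baseChange 𝕜[X]) :
    jacobiLeft ρ.conformalAct (superSign i j) a b x =
      jacobiRight G.quadraticBracket ρ.conformalAct a b x := by
  have bl : ∀ a b, G.quadraticBracket (del (𝕜 := 𝕜) a) b =
    -polyVar (𝕜 := 𝕜) (G.quadraticBracket a b) := sesquiExt_del_left _
  have br : ∀ a b, G.quadraticBracket a (del (𝕜 := 𝕜) b) =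
    (polyMap del + polyVar : Module.End 𝕜 (ℕ →₀ 𝕜[X] ⊗[𝕜] V)) (G.quadraticBracket a b) :=
    sesquiExt_del_right _
  have hl := ρ.conformalAct_del_left
  have hr := ρ.conformalAct_del_right
  have hx : x ∈ (⊤ : Submodule 𝕜 M).baseChange 𝕜[X] := by simp
  refine baseChange_induction (G.grading.part i) (p := fun a =>
    jacobiLeft ρ.conformalAct (superSign i j) a b x =
      jacobiRight G.quadraticBracket ρ.conformalAct a b x) ?_ ?_ ?_ ?_ ha
  · intro u hu
    refine baseChange_induction (G.grading.part j) (p := fun b =>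
      jacobiLeft ρ.conformalAct (superSign i j) ((1 : 𝕜[X]) ⊗ₜ u) b x =
        jacobiRight G.quadraticBracket ρ.conformalAct ((1 : 𝕜[X]) ⊗ₜ u) b x) ?_ ?_ ?_ ?_ hb
    · intro v hv
      refine baseChange_induction ⊤ (p := fun x =>
        jacobiLeft ρ.conformalAct (superSign i j) ((1 : 𝕜[X]) ⊗ₜ u) ((1 : 𝕜[X]) ⊗ₜ v) x =
          jacobiRight G.quadraticBracket ρ.conformalAct
            ((1 : 𝕜[X]) ⊗ₜ u) ((1 : 𝕜[X]) ⊗ₜ v) x) ?_ ?_ ?_ ?_ hx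
      · exact fun w _ => ρ.jacobi_one hu hv w
      · intro x y hx hy
        rw [jacobiLeft_add_right, jacobiRight_add_right, hx, hy]
      · intro r x hx
        rw [jacobiLeft_smul_right, jacobiRight_smul_right, hx]
      · intro x hx
        rw [jacobiLeft_del_right hr, jacobiRight_del_right hr, hx]
    · intro x y hx hy
      rw [jacobiLeft_add_mid, jacobiRight_add_mid, hx, hy]
    · intro r x hx
      rw [jacobiLeft_smul_mid, jacobiRight_smul_mid, hx]
    · intro x hx
      rw [jacobiLeft_del_mid hl, jacobiRight_del_mid hl br, hx]
  · intro x y hx hy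
    rw [jacobiLeft_add_left, jacobiRight_add_left, hx, hy]
  · intro r x hx
    rw [jacobiLeft_smul_left, jacobiRight_smul_left, hx]
  · intro x hx
    rw [jacobiLeft_del_left hl, jacobiRight_del_left bl, hx]

/-- The conformal representation of `L(V)` on `H ⊗ M` defined by a representation of `V`
on `M`. -/
noncomputable def conformalRep : ConformalRep G.quadratic (𝕜[X] ⊗[𝕜] M) where
  grading := ρ.grading.baseChange 𝕜[X]
  act := ρ.conformalAct
  act_mem := ρ.conformalAct_mem
  act_del_left := ρ.conformalAct_del_left
  act_del_right := ρ.conformalAct_del_right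
  jacobi := ρ.conformalAct_jacobi

/-! ### Faithfulness and finiteness -/

theorem del_injective : Function.Injective (del : Module.End 𝕜 (𝕜[X] ⊗[𝕜] V)) := by
  intro x y h
  exact smul_right_injective _ (X_ne_zero (R := 𝕜)) h

/-- If the maps `{a, ·}` and `d(a) ·` take a vector into the kernel of a linear map `π`, and
`π` takes its image under `a d(·)` to `a`, then the conformal representation is faithful. -/
theorem conformalRep_isFaithful (e : M) (π : M →ₗ[𝕜] V) (h₁ : ∀ a, π (ρ.lieAct a e) = 0)
    (h₂ : ∀ a, π (ρ.derAct a e) = 0) (h₃ : ∀ a, π (ρ.novAct a e) = a) :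
    ρ.conformalRep.IsFaithful := by
  refine (injective_iff_map_eq_zero _).2 fun z hz => ?_
  have hπ : ∀ x, π.baseChange 𝕜[X] (del (𝕜 := 𝕜) x) = del (𝕜 := 𝕜) (π.baseChange 𝕜[X] x) :=
    fun x => map_smul (π.baseChange 𝕜[X]) X x
  -- For `z = f(∂) a`, the action on `e` is `f(-λ)` times the action of `a`, and `π` leaves only
  -- `f(-λ) λ a`. Substituting `λ = -∂` turns this into `-∂ f(∂) a = -∂ z`, from which `z` is
  -- recovered because `∂` is injective on `H ⊗ V`.
  have key : polySubst (-del : Module.End 𝕜 (𝕜[X] ⊗[𝕜] V))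
      ((π.baseChange 𝕜[X]).restrictScalars 𝕜) (ρ.conformalAct z ((1 : 𝕜[X]) ⊗ₜ e)) =
      -del (𝕜 := 𝕜) z := by
    have hz' : z ∈ (⊤ : Submodule 𝕜 V).baseChange 𝕜[X] := by simp
    refine baseChange_induction ⊤ (p := fun z => polySubst (-del : Module.End 𝕜 (𝕜[X] ⊗[𝕜] V))
      ((π.baseChange 𝕜[X]).restrictScalars 𝕜) (ρ.conformalAct z ((1 : 𝕜[X]) ⊗ₜ e)) =
      -del (𝕜 := 𝕜) z) ?_ ?_ ?_ ?_ hz'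
    · intro u _
      simp only [conformalAct_one, map_add (polySubst _ _), polySubst_const, polySubst_var,
        LinearMap.coe_restrictScalars, hπ, LinearMap.baseChange_tmul, h₁, h₂, h₃, map_add,
        tmul_zero, map_zero, add_zero, zero_add, LinearMap.neg_apply]
    · intro x y hx hy
      simp only [map_add, LinearMap.add_apply, hx, hy, neg_add]
    · intro c x hx
      simp only [map_smul, LinearMap.smul_apply, hx, smul_neg]
    · intro x hx
      rw [conformalAct_del_left, map_neg, polySubst_var, hx, LinearMap.neg_apply, map_neg, neg_neg]
  have h0 : ρ.conformalAct z = 0 := hz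
  rw [h0, LinearMap.zero_apply, map_zero, zero_eq_neg] at key
  exact del_injective (key.trans (map_zero _).symm)

/-- `H ⊗ M` is finite over `H` because `M` is finite-dimensional. Taking `M` in the universe of `V`
puts the resulting module in `max y z`. -/
theorem hasFFR.{y, z} {𝕜 : Type y} {V : Type z} {M : Type z} [Field 𝕜] [AddCommGroup V]
    [Module 𝕜 V] {G : GDSuperalgebra 𝕜 V} [AddCommGroup M] [Module 𝕜 M] [FiniteDimensional 𝕜 M]
    (ρ : G.Rep M) (h : ρ.conformalRep.IsFaithful) :
    LieConformalSuperalgebra.HasFFR.{max y z} G.quadratic :=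
  ⟨𝕜[X] ⊗[𝕜] M, inferInstance, inferInstance, inferInstance, inferInstance, ρ.conformalRep,
    inferInstance, h⟩

end GDSuperalgebra.Rep

/-! ### Complements on `ℤ/2ℤ`-gradings -/

theorem zmod_two_cases (i : ZMod 2) : i = 0 ∨ i = 1 := by
  revert i; decide

namespace SuperGrading

variable {R M : Type*} [CommRing R] [AddCommGroup M] [Module R M] (g : SuperGrading R M)

theorem proj_mem (i : ZMod 2) (x : M) : g.proj i x ∈ g.part i := by
  simp [proj]

theorem proj_zero_add_proj_one (x : M) : g.proj 0 x + g.proj 1 x = x := by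
  have hx : x ∈ ⨆ i, g.part i := by
    rw [g.isInternal.submodule_iSup_eq_top]; trivial
  induction hx using Submodule.iSup_induction' with
  | mem i x hx =>
    rw [g.proj_of_mem _ hx, g.proj_of_mem _ hx]
    rcases zmod_two_cases i with rfl | rfl <;> simp
  | zero => simp
  | add x y _ _ hx hy => rw [map_add, map_add, add_add_add_comm, hx, hy]

theorem homogeneous_induction {p : M → Prop} (hom : ∀ i, ∀ x ∈ g.part i, p x)
    (add : ∀ x y, p x → p y → p (x + y)) (x : M) : p x := by
  rw [← g.proj_zero_add_proj_one x]
  exact add _ _ (hom _ _ (g.proj_mem _ _)) (hom _ _ (g.proj_mem _ _))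

theorem eq_zero_of_mem_of_mem {i j : ZMod 2} (hij : i ≠ j) {x : M} (hi : x ∈ g.part i)
    (hj : x ∈ g.part j) : x = 0 := by
  have h := g.proj_of_mem i hi
  rwa [g.proj_of_mem i hj, if_neg hij, if_pos rfl, eq_comm] at h

/-- A grading from its two complementary components. -/
def ofIsCompl (p : ZMod 2 → Submodule R M) (h : IsCompl (p 0) (p 1)) : SuperGrading R M where
  part := p
  isInternal := (DirectSum.isInternal_submodule_iff_isCompl p (i := 0) (j := 1) (by decide)
    (by ext i; rcases zmod_two_cases i with rfl | rfl <;> simp)).2 h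

end SuperGrading

/-! ### The three operators on `P ⊕ (𝕜 ⊕ P) e` -/

namespace DiffPoissonSuperalgebra

variable {𝕜 P : Type*} [Field 𝕜] [AddCommGroup P] [Module 𝕜 P] (𝔓 : DiffPoissonSuperalgebra 𝕜 P)
  {i j : ZMod 2} {a b : P}

theorem mul_left_comm (x : P) (ha : a ∈ 𝔓.grading.part i) (hb : b ∈ 𝔓.grading.part j) :
    𝔓.mul b (𝔓.mul a x) = superSign i j • 𝔓.mul a (𝔓.mul b x) := by
  rw [← 𝔓.mul_assoc, 𝔓.mul_comm hb ha, superSign_comm, map_zsmul, LinearMap.smul_apply,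
    𝔓.mul_assoc]

/-- Follows from the Leibniz rule in the second argument by skew-symmetry. The latter needs a
homogeneous `x`, hence the reduction by linearity. -/
theorem leibniz_right (x : P) (ha : a ∈ 𝔓.grading.part i) (hb : b ∈ 𝔓.grading.part j) :
    𝔓.bracket (𝔓.mul a b) x =
      𝔓.mul a (𝔓.bracket b x) + superSign i j • 𝔓.mul b (𝔓.bracket a x) := by
  refine 𝔓.grading.homogeneous_induction (p := fun x => 𝔓.bracket (𝔓.mul a b) x =
    𝔓.mul a (𝔓.bracket b x) + superSign i j • 𝔓.mul b (𝔓.bracket a x))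
    (fun k x hx => ?_) (fun x y hx hy => ?_) x
  · rw [𝔓.bracket_skew (𝔓.mul_mem ha hb) hx, 𝔓.leibniz b hx ha, 𝔓.bracket_skew hx ha,
      𝔓.bracket_skew hx hb, map_neg, map_neg, map_zsmul, map_zsmul, LinearMap.neg_apply,
      LinearMap.smul_apply, 𝔓.mul_comm (𝔓.bracket_mem ha hx) hb, superSign_add_left,
      superSign_add_left, superSign_comm k i, superSign_comm k j]
    rcases superSign_eq i j with h1 | h1 <;> rcases superSign_eq i k with h2 | h2 <;>
    rcases superSign_eq j k with h3 | h3 <;> rw [h1, h2, h3] <;> module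
  · simp only [map_add, hx, hy]
    module

/-- The operator `{a, ·}` on `P ⊕ (𝕜 ⊕ P) e`, where `d(e) = 1` and `{P, e} = 0`. -/
def hullLie (a : P) (n : P × 𝕜 × P) : P × 𝕜 × P :=
  (𝔓.bracket a n.1, 0, 𝔓.bracket a n.2.2)

/-- The operator `a d(·)` on `P ⊕ (𝕜 ⊕ P) e`, where `d(e) = 1`. -/
def hullNov (a : P) (n : P × 𝕜 × P) : P × 𝕜 × P :=
  (𝔓.mul a (𝔓.d n.1) + n.2.1 • a + 𝔓.mul a n.2.2, 0, 𝔓.mul a (𝔓.d n.2.2))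

/-- The operator `d(a) ·` on `P ⊕ (𝕜 ⊕ P) e`. -/
def hullDer (a : P) (n : P × 𝕜 × P) : P × 𝕜 × P :=
  (𝔓.mul (𝔓.d a) n.1, 0, n.2.1 • 𝔓.d a + 𝔓.mul (𝔓.d a) n.2.2)

/-- This and the next six lemmas are the axioms of `Rep` for the formal module `P ⊕ (𝕜 ⊕ P) e`, with
`a d(b)` and `{a, b}` in place of `a ∘ b` and `[a, b]`. Each is checked by components: the
operations are expanded, products and brackets are put in a fixed order, and the signs are compared
case by case. -/
theorem hullLie_lie (n : P × 𝕜 × P) (ha : a ∈ 𝔓.grading.part i) (hb : b ∈ 𝔓.grading.part j) :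
    𝔓.hullLie (𝔓.bracket a b) n =
    𝔓.hullLie a (𝔓.hullLie b n) - superSign i j • 𝔓.hullLie b (𝔓.hullLie a n) := by
  have h := fun x => 𝔓.bracket_jacobi x ha hb
  have hs := superSign_eq i j
  ext <;>
  simp only [hullLie, smul_zero, sub_zero, Prod.fst_sub, Prod.snd_sub, Prod.smul_fst,
    Prod.smul_snd, h] <;>
  (try rcases hs with e | e <;> rw [e] <;> module)

theorem hullDer_comm (n : P × 𝕜 × P) (ha : a ∈ 𝔓.grading.part i) (hb : b ∈ 𝔓.grading.part j) :
    𝔓.hullDer a (𝔓.hullDer b n) =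
    superSign i j • 𝔓.hullDer b (𝔓.hullDer a n) := by
  have h := fun x => 𝔓.mul_left_comm x (𝔓.d_mem ha) (𝔓.d_mem hb)
  have h' := 𝔓.mul_comm (𝔓.d_mem hb) (𝔓.d_mem ha)
  rw [superSign_comm] at h'
  have hs := superSign_eq i j
  ext <;>
  simp only [hullDer, map_add, map_smul, zero_smul, zero_add, smul_zero, Prod.smul_fst,
    Prod.smul_snd, h, h'] <;>
  (try rcases hs with e | e <;> rw [e] <;> module)

theorem hullDer_nov (n : P × 𝕜 × P) (ha : a ∈ 𝔓.grading.part i) (hb : b ∈ 𝔓.grading.part j) :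
    𝔓.hullDer (𝔓.mul a (𝔓.d b)) n =
    𝔓.hullNov a (𝔓.hullDer b n) - superSign i j • 𝔓.hullDer b (𝔓.hullNov a n)
      + 𝔓.hullDer a (𝔓.hullDer b n) := by
  have h := fun x => 𝔓.mul_left_comm x ha (𝔓.d_mem hb)
  have h' := 𝔓.mul_comm (𝔓.d_mem hb) ha
  rw [superSign_comm] at h'
  have hs := superSign_eq i j
  ext <;>
  simp only [hullDer, hullNov, map_add, map_smul, zero_smul, zero_add, add_zero, smul_zero,
    sub_zero, LinearMap.add_apply, Prod.fst_add, Prod.snd_add, Prod.fst_sub, Prod.snd_sub,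
    Prod.smul_fst, Prod.smul_snd, 𝔓.d_mul, 𝔓.mul_assoc, h, h'] <;>
  (try rcases hs with e | e <;> rw [e] <;> module)

theorem hullNov_nov (n : P × 𝕜 × P) (ha : a ∈ 𝔓.grading.part i) (hb : b ∈ 𝔓.grading.part j) :
    𝔓.hullNov (𝔓.mul a (𝔓.d b)) n =
    superSign i j • 𝔓.hullDer b (𝔓.hullNov a n) := by
  have h := fun x => 𝔓.mul_left_comm x ha (𝔓.d_mem hb)
  have h' := 𝔓.mul_comm (𝔓.d_mem hb) ha
  rw [superSign_comm] at h'
  have hs := superSign_eq i j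
  ext <;>
  simp only [hullDer, hullNov, map_add, map_smul, zero_smul, zero_add, smul_zero, Prod.smul_fst,
    Prod.smul_snd, 𝔓.mul_assoc, h, h'] <;>
  (try rcases hs with e | e <;> rw [e] <;> module)

theorem hullNov_comm (n : P × 𝕜 × P) (ha : a ∈ 𝔓.grading.part i) (hb : b ∈ 𝔓.grading.part j) :
    𝔓.hullNov a (𝔓.hullNov b n) - superSign i j • 𝔓.hullNov b (𝔓.hullNov a n) =
    𝔓.hullNov (𝔓.mul a (𝔓.d b)) n - superSign i j • 𝔓.hullNov (𝔓.mul b (𝔓.d a)) n := by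
  have h := fun x => 𝔓.mul_left_comm x ha hb
  have hs := superSign_eq i j
  ext <;>
  simp only [hullNov, map_add, map_smul, zero_smul, add_zero, smul_zero, sub_zero, Prod.fst_sub,
    Prod.snd_sub, Prod.smul_fst, Prod.smul_snd, 𝔓.d_mul, 𝔓.mul_assoc, h] <;>
  (try rcases hs with e | e <;> rw [e] <;> module)

theorem hullDer_lie (n : P × 𝕜 × P) (ha : a ∈ 𝔓.grading.part i) (hb : b ∈ 𝔓.grading.part j) :
    𝔓.hullDer (𝔓.bracket a b) n =
    𝔓.hullLie a (𝔓.hullDer b n) - superSign i j • 𝔓.hullDer b (𝔓.hullLie a n)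
      + 𝔓.hullDer a (𝔓.hullLie b n) - superSign i j • 𝔓.hullLie b (𝔓.hullDer a n) := by
  have h := fun x => 𝔓.leibniz x ha (𝔓.d_mem hb)
  have h' := fun x => 𝔓.leibniz x hb (𝔓.d_mem ha)
  have h'' := 𝔓.bracket_skew hb (𝔓.d_mem ha)
  simp only [superSign_comm j i] at h' h''
  have hs := superSign_eq i j
  ext <;>
  simp only [hullDer, hullLie, map_add, map_neg, map_smul, map_zsmul, zero_smul, zero_add,
    add_zero, smul_zero, sub_zero, LinearMap.add_apply, LinearMap.neg_apply, LinearMap.smul_apply,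
    Prod.fst_add, Prod.snd_add, Prod.fst_sub, Prod.snd_sub, Prod.smul_fst, Prod.smul_snd,
    𝔓.d_bracket, h, h', h''] <;>
  (try rcases hs with e | e <;> rw [e] <;> module)

theorem hullNov_lie (n : P × 𝕜 × P) (ha : a ∈ 𝔓.grading.part i) (hb : b ∈ 𝔓.grading.part j) :
    𝔓.hullNov (𝔓.bracket a b) n + 𝔓.hullLie (𝔓.mul a (𝔓.d b)) n =
    𝔓.hullNov a (𝔓.hullLie b n) - superSign i j • 𝔓.hullLie b (𝔓.hullNov a n)
      + superSign i j • 𝔓.hullDer b (𝔓.hullLie a n) := by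
  have h := fun x => 𝔓.leibniz_right x ha (𝔓.d_mem hb)
  have h' := fun x => 𝔓.leibniz x hb ha
  have h'' := 𝔓.bracket_skew hb ha
  simp only [superSign_comm j i] at h' h''
  have hs := superSign_eq i j
  ext <;>
  simp only [hullNov, hullDer, hullLie, map_add, map_neg, map_smul, map_zsmul, zero_smul,
    zero_add, add_zero, smul_zero, sub_zero, LinearMap.neg_apply, LinearMap.smul_apply,
    Prod.fst_add, Prod.snd_add, Prod.fst_sub, Prod.snd_sub, Prod.smul_fst, Prod.smul_snd,
    𝔓.d_bracket, h, h', h''] <;>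
  (try rcases hs with e | e <;> rw [e] <;> module)

end DiffPoissonSuperalgebra

/-! ### Poisson embeddings and the three operators on `V ⊕ End(V)` -/

/-- An embedding of a GD-superalgebra into a differential Poisson superalgebra. -/
structure GDSuperalgebra.PoissonEmbedding {𝕜 V P : Type*} [Field 𝕜] [AddCommGroup V] [Module 𝕜 V]
    [AddCommGroup P] [Module 𝕜 P] (G : GDSuperalgebra 𝕜 V) (𝔓 : DiffPoissonSuperalgebra 𝕜 P) where
  toLinearMap : V →ₗ[𝕜] P
  injective : Function.Injective toLinearMap
  map_mem : ∀ i, ∀ a ∈ G.grading.part i, toLinearMap a ∈ 𝔓.grading.part i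
  map_nov : ∀ a b, toLinearMap (G.nov a b) = 𝔓.mul (toLinearMap a) (𝔓.d (toLinearMap b))
  map_lie : ∀ a b, toLinearMap (G.lie a b) = 𝔓.bracket (toLinearMap a) (toLinearMap b)

namespace GDSuperalgebra

section Operators

variable {𝕜 V : Type*} [Field 𝕜] [AddCommGroup V] [Module 𝕜 V] (G : GDSuperalgebra 𝕜 V)

/-- The operator `v ↦ (-1)^{i|v|} v`. -/
noncomputable def koszul (i : ZMod 2) : Module.End 𝕜 V :=
  ∑ j : ZMod 2, superSign i j • G.grading.proj j

theorem koszul_apply (i : ZMod 2) {j : ZMod 2} {v : V} (hv : v ∈ G.grading.part j) :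
    G.koszul i v = superSign i j • v := by
  simp only [koszul, LinearMap.sum_apply, LinearMap.smul_apply, G.grading.proj_of_mem _ hv]
  rw [Finset.sum_eq_single j] <;> simp +contextual

/-- The twisted commutator `(a, φ) ↦ (v ↦ (-1)^{|a||v|} (B(a, φ(v)) - φ(B(a, v))))`. -/
noncomputable def twistedCommutator (B : V →ₗ[𝕜] V →ₗ[𝕜] V) :
    V →ₗ[𝕜] Module.End 𝕜 V →ₗ[𝕜] Module.End 𝕜 V :=
  ∑ i : ZMod 2, ((LinearMap.mul 𝕜 (Module.End 𝕜 V) - (LinearMap.mul 𝕜 (Module.End 𝕜 V)).flip) ∘ₗ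
    B ∘ₗ G.grading.proj i).compr₂ (LinearMap.mulRight 𝕜 (G.koszul i))

/-- The form of the right side is explained by `v {a, q} = (-1)^{|a||v|} ({a, v q} - {a, v} q)` and
`v a d(q) = (-1)^{|a||v|} (a d(v q) - a d(v) q)`. If `φ` is right multiplication by `q`, then for `B
= lie` and `B = nov` the result is right multiplication by `{a, q}` and by `a d(q)`. A scalar added
to `q` cancels in the commutator. -/
theorem twistedCommutator_apply (B : V →ₗ[𝕜] V →ₗ[𝕜] V) {i j : ZMod 2} {a v : V}
    (ha : a ∈ G.grading.part i) (hv : v ∈ G.grading.part j) (φ : Module.End 𝕜 V) :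
    G.twistedCommutator B a φ v = superSign i j • (B a (φ v) - φ (B a v)) := by
  simp only [twistedCommutator, LinearMap.sum_apply, LinearMap.compr₂_apply, LinearMap.comp_apply,
    G.grading.proj_of_mem _ ha]
  rw [Finset.sum_eq_single i]
  · simp [G.koszul_apply i hv, smul_sub]
  · simp +contextual
  · simp

/-- The operator `{a, ·}` on `V ⊕ End(V)`, where `φ ∈ End(V)` is the right multiplication by an
element of weight zero. -/
noncomputable def endLie : V →ₗ[𝕜] (V × Module.End 𝕜 V) →ₗ[𝕜] V × Module.End 𝕜 V :=
  (G.lie.compl₂ (LinearMap.fst 𝕜 _ _)).compr₂ (LinearMap.inl 𝕜 _ _)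
    + ((G.twistedCommutator G.lie).compl₂ (LinearMap.snd 𝕜 _ _)).compr₂ (LinearMap.inr 𝕜 _ _)

theorem endLie_apply (a : V) (m : V × Module.End 𝕜 V) :
    G.endLie a m = (G.lie a m.1, G.twistedCommutator G.lie a m.2) := by
  simp [endLie]

/-- The operator `a d(·)` on `V ⊕ End(V)`. -/
noncomputable def endNov : V →ₗ[𝕜] (V × Module.End 𝕜 V) →ₗ[𝕜] V × Module.End 𝕜 V :=
  (G.nov.compl₂ (LinearMap.fst 𝕜 _ _)
      + LinearMap.applyₗ.compl₂ (LinearMap.snd 𝕜 V (V →ₗ[𝕜] V))).compr₂ (LinearMap.inl 𝕜 _ _)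
    + ((G.twistedCommutator G.nov).compl₂ (LinearMap.snd 𝕜 _ _)).compr₂ (LinearMap.inr 𝕜 _ _)

/-- The term `m.2 a` is the contribution of `d(e) = 1`: `a d(q e) = a q + a d(q) e`. -/
theorem endNov_apply (a : V) (m : V × Module.End 𝕜 V) :
    G.endNov a m = (G.nov a m.1 + m.2 a, G.twistedCommutator G.nov a m.2) := by
  simp [endNov]

/-- The operator `d(a) ·` on `V ⊕ End(V)`. -/
noncomputable def endDer : V →ₗ[𝕜] (V × Module.End 𝕜 V) →ₗ[𝕜] V × Module.End 𝕜 V :=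
  (G.novOp.compl₂ (LinearMap.fst 𝕜 _ _)).compr₂ (LinearMap.inl 𝕜 _ _)
    + (((LinearMap.mul 𝕜 (Module.End 𝕜 V)).flip ∘ₗ G.nov.flip).compl₂
      (LinearMap.snd 𝕜 _ _)).compr₂ (LinearMap.inr 𝕜 _ _)

/-- The second component reflects `v (d(a) q) = (v d(a)) q = (v ∘ a) q`, so it involves no sign. -/
theorem endDer_apply (a : V) (m : V × Module.End 𝕜 V) :
    G.endDer a m = (G.novOp a m.1, m.2 ∘ₗ G.nov.flip a) := by
  simp [endDer, Module.End.mul_eq_comp]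

/-- The homogeneous components of `V ⊕ End(V)`. -/
def endPart (i : ZMod 2) : Submodule 𝕜 (V × Module.End 𝕜 V) where
  carrier := {m | m.1 ∈ G.grading.part i ∧
    ∀ j, ∀ v ∈ G.grading.part j, m.2 v ∈ G.grading.part (i + j)}
  zero_mem' := ⟨zero_mem _, fun _ _ _ => zero_mem _⟩
  add_mem' h h' := ⟨add_mem h.1 h'.1, fun j v hv => add_mem (h.2 j v hv) (h'.2 j v hv)⟩
  smul_mem' c _ h :=
    ⟨Submodule.smul_mem _ c h.1, fun j v hv => Submodule.smul_mem _ c (h.2 j v hv)⟩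

/-- The projections onto the homogeneous components of `V ⊕ End(V)`. -/
noncomputable def endProj (i : ZMod 2) (m : V × Module.End 𝕜 V) : V × Module.End 𝕜 V :=
  (G.grading.proj i m.1, ∑ j : ZMod 2, G.grading.proj (i + j) ∘ₗ m.2 ∘ₗ G.grading.proj j)

theorem endProj_snd_apply (i : ZMod 2) {j : ZMod 2} {v : V} (hv : v ∈ G.grading.part j)
    (m : V × Module.End 𝕜 V) : (G.endProj i m).2 v = G.grading.proj (i + j) (m.2 v) := by
  simp only [endProj, LinearMap.sum_apply, LinearMap.comp_apply, G.grading.proj_of_mem _ hv]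
  rw [Finset.sum_eq_single j] <;> simp +contextual

theorem endProj_mem (i : ZMod 2) (m : V × Module.End 𝕜 V) : G.endProj i m ∈ G.endPart i :=
  ⟨G.grading.proj_mem _ _, fun j v hv => by
    rw [G.endProj_snd_apply i hv]; exact G.grading.proj_mem _ _⟩

theorem end_ext {φ ψ : Module.End 𝕜 V} (h : ∀ i, ∀ v ∈ G.grading.part i, φ v = ψ v) : φ = ψ :=
  LinearMap.ext <| G.grading.homogeneous_induction h fun x y hx hy => by rw [map_add, map_add, hx, hy]

theorem endProj_zero_add_endProj_one (m : V × Module.End 𝕜 V) :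
    G.endProj 0 m + G.endProj 1 m = m := by
  refine Prod.ext (G.grading.proj_zero_add_proj_one _) (G.end_ext fun j v hv => ?_)
  rw [Prod.snd_add, LinearMap.add_apply, G.endProj_snd_apply _ hv, G.endProj_snd_apply _ hv]
  -- The components of `m.2 v` that occur have parities `0 + j` and `1 + j`; for odd `v` they come
  -- in the opposite order.
  rcases zmod_two_cases j with rfl | rfl
  · exact G.grading.proj_zero_add_proj_one _
  · rw [add_comm]
    exact G.grading.proj_zero_add_proj_one _

theorem eq_zero_of_mem_endPart {m : V × Module.End 𝕜 V} (h₀ : m ∈ G.endPart 0)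
    (h₁ : m ∈ G.endPart 1) : m = 0 := by
  refine Prod.ext (G.grading.eq_zero_of_mem_of_mem zero_ne_one h₀.1 h₁.1) (G.end_ext fun j v hv => ?_)
  exact G.grading.eq_zero_of_mem_of_mem ((by decide : ∀ j : ZMod 2, 0 + j ≠ 1 + j) j)
     (h₀.2 j v hv) (h₁.2 j v hv)

variable {i j : ZMod 2} {a : V} {m : V × Module.End 𝕜 V}

theorem twistedCommutator_mem {B : V →ₗ[𝕜] V →ₗ[𝕜] V}
    (hB : ∀ {i j : ZMod 2} {a b : V}, a ∈ G.grading.part i → b ∈ G.grading.part j →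
      B a b ∈ G.grading.part (i + j))
    (ha : a ∈ G.grading.part i) (hm : m ∈ G.endPart j) (k : ZMod 2) (v : V)
    (hv : v ∈ G.grading.part k) :
    G.twistedCommutator B a m.2 v ∈ G.grading.part (i + j + k) := by
  rw [G.twistedCommutator_apply B ha hv]
  refine zsmul_mem (sub_mem ?_ ?_) _
  · rw [add_assoc]
    exact hB ha (hm.2 k v hv)
  · rw [add_comm i j, add_assoc]
    exact hm.2 _ _ (hB ha hv)

theorem endLie_mem (ha : a ∈ G.grading.part i) (hm : m ∈ G.endPart j) :
    G.endLie a m ∈ G.endPart (i + j) := by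
  rw [endLie_apply]
  exact ⟨G.lie_mem ha hm.1, G.twistedCommutator_mem G.lie_mem ha hm⟩

theorem endNov_mem (ha : a ∈ G.grading.part i) (hm : m ∈ G.endPart j) :
    G.endNov a m ∈ G.endPart (i + j) := by
  rw [endNov_apply]
  refine ⟨add_mem (G.nov_mem ha hm.1) ?_, G.twistedCommutator_mem G.nov_mem ha hm⟩
  rw [add_comm]
  exact hm.2 _ _ ha

theorem endDer_mem (ha : a ∈ G.grading.part i) (hm : m ∈ G.endPart j) :
    G.endDer a m ∈ G.endPart (i + j) := by
  rw [endDer_apply]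
  refine ⟨?_, fun k v hv => ?_⟩
  · rw [G.novOp_apply ha hm.1, add_comm]
    exact zsmul_mem (G.nov_mem hm.1 ha) _
  · rw [add_comm i j, add_assoc, add_comm i k]
    exact hm.2 _ _ (G.nov_mem hv ha)

end Operators

/-! ### Representing pairs in `V ⊕ End(V)` by vectors of `P ⊕ (𝕜 ⊕ P) e` -/

namespace PoissonEmbedding

variable {𝕜 V P : Type*} [Field 𝕜] [AddCommGroup V] [Module 𝕜 V]
    [AddCommGroup P] [Module 𝕜 P] {G : GDSuperalgebra 𝕜 V} {𝔓 : DiffPoissonSuperalgebra 𝕜 P}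
    (τ : G.PoissonEmbedding 𝔓)

/-- The vector `(q, (c + p) e)` of `P ⊕ (𝕜 ⊕ P) e` represents `(x, φ) ∈ V ⊕ End(V)` if `q = τ(x)`
and the right multiplication by `c + p` acts on `V` as `φ`. -/
def Lifts (n : P × 𝕜 × P) (m : V × Module.End 𝕜 V) : Prop :=
  n.1 = τ.toLinearMap m.1 ∧
    ∀ v, τ.toLinearMap (m.2 v) = n.2.1 • τ.toLinearMap v + 𝔓.mul (τ.toLinearMap v) n.2.2

variable {τ}

theorem Lifts.add {n n' : P × 𝕜 × P} {m m' : V × Module.End 𝕜 V} (h : τ.Lifts n m)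
    (h' : τ.Lifts n' m') : τ.Lifts (n + n') (m + m') :=
  ⟨by simp [h.1, h'.1], fun v => by
    simp only [Prod.snd_add, Prod.fst_add, LinearMap.add_apply, map_add, h.2, h'.2]
    module⟩

theorem Lifts.sub {n n' : P × 𝕜 × P} {m m' : V × Module.End 𝕜 V} (h : τ.Lifts n m)
    (h' : τ.Lifts n' m') : τ.Lifts (n - n') (m - m') :=
  ⟨by simp [h.1, h'.1], fun v => by
    simp only [Prod.snd_sub, Prod.fst_sub, LinearMap.sub_apply, map_sub, h.2, h'.2]
    module⟩

theorem Lifts.smul (c : 𝕜) {n : P × 𝕜 × P} {m : V × Module.End 𝕜 V} (h : τ.Lifts n m) :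
    τ.Lifts (c • n) (c • m) :=
  ⟨by simp [h.1], fun v => by
    simp only [Prod.smul_snd, Prod.smul_fst, LinearMap.smul_apply, map_smul, h.2, smul_eq_mul]
    module⟩

theorem Lifts.zsmul (c : ℤ) {n : P × 𝕜 × P} {m : V × Module.End 𝕜 V} (h : τ.Lifts n m) :
    τ.Lifts (c • n) (c • m) := by
  simpa only [Int.cast_smul_eq_zsmul] using h.smul (c : 𝕜)

/-- A pair may have many representing vectors, since different `q` can multiply `V` in the same way,
but a representing vector has only one pair because `τ` is injective. This is what carries
identities from `P ⊕ (𝕜 ⊕ P) e` to the hull. -/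
theorem Lifts.unique {n n' : P × 𝕜 × P} {m m' : V × Module.End 𝕜 V} (h : τ.Lifts n m)
    (h' : τ.Lifts n' m') (hn : n = n') : m = m' := by
  subst hn
  exact Prod.ext (τ.injective (h.1.symm.trans h'.1))
    (LinearMap.ext fun v => τ.injective ((h.2 v).trans (h'.2 v).symm))

/-- The second condition in the definition of `Lifts` has to be checked for homogeneous vectors
only. -/
theorem Lifts.of_homogeneous {n : P × 𝕜 × P} {m : V × Module.End 𝕜 V}
    (h : n.1 = τ.toLinearMap m.1)
    (h' : ∀ i, ∀ v ∈ G.grading.part i,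
      τ.toLinearMap (m.2 v) = n.2.1 • τ.toLinearMap v + 𝔓.mul (τ.toLinearMap v) n.2.2) :
    τ.Lifts n m :=
  ⟨h, G.grading.homogeneous_induction h' fun x y hx hy => by
    simp only [map_add, LinearMap.add_apply, hx, hy]
    module⟩

/-- By the Leibniz rule, `v {a, q}` is the twisted commutator of `{a, ·}` with the right
multiplication by `q`. -/
theorem Lifts.lie {n : P × 𝕜 × P} {m : V × Module.End 𝕜 V} (h : τ.Lifts n m) (a : V) :
    τ.Lifts (𝔓.hullLie (τ.toLinearMap a) n) (G.endLie a m) := by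
  refine G.grading.homogeneous_induction (p := fun a =>
    τ.Lifts (𝔓.hullLie (τ.toLinearMap a) n) (G.endLie a m)) (fun i a ha => ?_)
    (fun a b ha hb => ?_) a
  · rw [endLie_apply]
    refine .of_homogeneous (by simp [DiffPoissonSuperalgebra.hullLie, h.1, τ.map_lie])
      fun j v hv => ?_
    have hl := 𝔓.leibniz n.2.2 (τ.map_mem i a ha) (τ.map_mem j v hv)
    simp only [G.twistedCommutator_apply _ ha hv, DiffPoissonSuperalgebra.hullLie, map_zsmul, map_sub,
      τ.map_lie, h.2, map_add, map_smul, hl]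
    rcases superSign_eq i j with e | e <;> rw [e] <;> module
  · convert ha.add hb using 1
    · ext <;> simp [DiffPoissonSuperalgebra.hullLie]
    · simp

/-- The derivation rule for `d` makes `v a d(q)` a twisted commutator. The term `φ(a)` in the first
component matches `c a + a q`. -/
theorem Lifts.nov {n : P × 𝕜 × P} {m : V × Module.End 𝕜 V} (h : τ.Lifts n m) (a : V) :
    τ.Lifts (𝔓.hullNov (τ.toLinearMap a) n) (G.endNov a m) := by
  refine G.grading.homogeneous_induction (p := fun a =>
    τ.Lifts (𝔓.hullNov (τ.toLinearMap a) n) (G.endNov a m)) (fun i a ha => ?_)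
    (fun a b ha hb => ?_) a
  · rw [endNov_apply]
    refine .of_homogeneous (by
      simp [DiffPoissonSuperalgebra.hullNov, h.1, h.2, τ.map_nov, add_assoc]) fun j v hv => ?_
    have hl := 𝔓.mul_left_comm (𝔓.d n.2.2) (τ.map_mem i a ha) (τ.map_mem j v hv)
    simp only [G.twistedCommutator_apply _ ha hv, DiffPoissonSuperalgebra.hullNov, map_zsmul, map_sub,
      τ.map_nov, h.2, map_add, map_smul, 𝔓.d_mul, 𝔓.mul_assoc, hl]
    rcases superSign_eq i j with e | e <;> rw [e] <;> module
  · convert ha.add hb using 1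
    · ext <;> simp [DiffPoissonSuperalgebra.hullNov]; module
    · simp

/-- The sign in `novOp` is exactly the one for moving `d(a)` to the left of `b`. -/
theorem map_novOp (a b : V) : τ.toLinearMap (G.novOp a b) =
    𝔓.mul (𝔓.d (τ.toLinearMap a)) (τ.toLinearMap b) := by
  refine G.grading.homogeneous_induction (p := fun a => τ.toLinearMap (G.novOp a b) =
    𝔓.mul (𝔓.d (τ.toLinearMap a)) (τ.toLinearMap b)) (fun i a ha => ?_)
    (fun x y hx hy => by simp only [map_add, LinearMap.add_apply, hx, hy]) a
  refine G.grading.homogeneous_induction (p := fun b => τ.toLinearMap (G.novOp a b) =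
    𝔓.mul (𝔓.d (τ.toLinearMap a)) (τ.toLinearMap b)) (fun j b hb => ?_)
    (fun x y hx hy => by simp only [map_add, hx, hy]) b
  rw [G.novOp_apply ha hb, map_zsmul, τ.map_nov,
    𝔓.mul_comm (𝔓.d_mem (τ.map_mem i a ha)) (τ.map_mem j b hb)]

theorem Lifts.der {n : P × 𝕜 × P} {m : V × Module.End 𝕜 V} (h : τ.Lifts n m) (a : V) :
    τ.Lifts (𝔓.hullDer (τ.toLinearMap a) n) (G.endDer a m) := by
  rw [endDer_apply]
  refine ⟨by simp [DiffPoissonSuperalgebra.hullDer, h.1, map_novOp], fun v => ?_⟩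
  simp [DiffPoissonSuperalgebra.hullDer, h.2, τ.map_nov, 𝔓.mul_assoc]

theorem map_proj (i : ZMod 2) (v : V) :
    τ.toLinearMap (G.grading.proj i v) = 𝔓.grading.proj i (τ.toLinearMap v) := by
  refine G.grading.homogeneous_induction (p := fun v =>
    τ.toLinearMap (G.grading.proj i v) = 𝔓.grading.proj i (τ.toLinearMap v)) (fun j v hv => ?_)
    (fun x y hx hy => by simp only [map_add, hx, hy]) v
  rw [G.grading.proj_of_mem _ hv, 𝔓.grading.proj_of_mem _ (τ.map_mem j v hv)]
  split_ifs <;> simp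

/-- The hull is a graded subspace: homogeneous components of a pair are represented by those of its
representing vector. Since `e` and the scalars are even, `c` belongs to the component `i = 0`. -/
theorem Lifts.proj {n : P × 𝕜 × P} {m : V × Module.End 𝕜 V} (h : τ.Lifts n m) (i : ZMod 2) :
    τ.Lifts (𝔓.grading.proj i n.1, if i = 0 then n.2.1 else 0, 𝔓.grading.proj i n.2.2)
      (G.endProj i m) := by
  refine .of_homogeneous (by rw [h.1, ← map_proj]; rfl) fun j v hv => ?_
  have hv' := τ.map_mem j v hv
  rw [G.endProj_snd_apply i hv, map_proj, h.2, map_add, map_smul, 𝔓.grading.proj_of_mem _ hv']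
  congr 1
  · by_cases hi : i = 0 <;> simp [hi]
  · refine 𝔓.grading.homogeneous_induction (p := fun p => 𝔓.grading.proj (i + j)
      (𝔓.mul (τ.toLinearMap v) p) = 𝔓.mul (τ.toLinearMap v) (𝔓.grading.proj i p))
      (fun k p hp => ?_) (fun x y hx hy => by simp only [map_add, hx, hy]) _
    rw [𝔓.grading.proj_of_mem _ hp, 𝔓.grading.proj_of_mem _ (𝔓.mul_mem hv' hp), add_comm j k]
    by_cases hi : i = k <;> simp [hi]

/-! ### The hull as a finite-dimensional faithful representation -/

variable (τ)

/-- The vectors of `V ⊕ End(V)` which are represented by vectors of `P ⊕ (𝕜 ⊕ P) e`. -/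
def hull : Submodule 𝕜 (V × Module.End 𝕜 V) where
  carrier := {m | ∃ n, τ.Lifts n m}
  zero_mem' := ⟨0, by simp, by simp⟩
  add_mem' := fun ⟨_, h⟩ ⟨_, h'⟩ => ⟨_, h.add h'⟩
  smul_mem' := fun c _ ⟨_, h⟩ => ⟨_, h.smul c⟩

/-- The restriction of a family of operators on `E` to an invariant subspace. -/
def _root_.LinearMap.restrictFamily {𝕜 V E : Type*} [Field 𝕜] [AddCommGroup V] [Module 𝕜 V]
    [AddCommGroup E] [Module 𝕜 E] (f : V →ₗ[𝕜] E →ₗ[𝕜] E) (U : Submodule 𝕜 E)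
    (h : ∀ a, ∀ x ∈ U, f a x ∈ U) : V →ₗ[𝕜] U →ₗ[𝕜] U :=
  LinearMap.mk₂ 𝕜 (fun a x => ⟨f a x, h a x x.2⟩) (fun _ _ _ => Subtype.ext (by simp))
    (fun _ _ _ => Subtype.ext (by simp)) (fun _ _ _ => Subtype.ext (by simp))
    (fun _ _ _ => Subtype.ext (by simp))

/-- The grading of the hull. -/
def hullGrading : SuperGrading 𝕜 τ.hull :=
  .ofIsCompl (fun i => (G.endPart i).comap τ.hull.subtype) <| by
    refine IsCompl.of_eq (Submodule.eq_bot_iff _ |>.2 fun x hx => ?_) (eq_top_iff.2 fun x _ => ?_)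
    · exact Subtype.ext (G.eq_zero_of_mem_endPart hx.1 hx.2)
    · obtain ⟨n, hn⟩ := x.2
      exact Submodule.mem_sup.2 ⟨⟨_, _, hn.proj 0⟩, G.endProj_mem 0 _, ⟨_, _, hn.proj 1⟩,
        G.endProj_mem 1 _, Subtype.ext (G.endProj_zero_add_endProj_one _)⟩

/-- The representation of a special GD-superalgebra on the hull. -/
noncomputable def rep : G.Rep τ.hull where
  grading := τ.hullGrading
  lieAct := G.endLie.restrictFamily _ fun a _ ⟨_, h⟩ => ⟨_, h.lie a⟩
  novAct := G.endNov.restrictFamily _ fun a _ ⟨_, h⟩ => ⟨_, h.nov a⟩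
  derAct := G.endDer.restrictFamily _ fun a _ ⟨_, h⟩ => ⟨_, h.der a⟩
  lieAct_mem ha hx := G.endLie_mem ha hx
  novAct_mem ha hx := G.endNov_mem ha hx
  derAct_mem ha hx := G.endDer_mem ha hx
  lieAct_lie {i j a b} x ha hb := by
    obtain ⟨n, h⟩ := x.2
    -- The pattern for all the axioms below: the two sides are represented by the corresponding
    -- expressions in a representing vector `n` of `x`, and these agree by the identity in `P ⊕ (𝕜 ⊕
    -- P) e`.
    refine Subtype.ext ((h.lie _).unique (((h.lie b).lie a).sub (((h.lie a).lie b).zsmul _)) ?_)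
    rw [τ.map_lie]
    exact 𝔓.hullLie_lie n (τ.map_mem _ _ ha) (τ.map_mem _ _ hb)
  derAct_comm {i j a b} x ha hb := by
    obtain ⟨n, h⟩ := x.2
    exact Subtype.ext (((h.der b).der a).unique (((h.der a).der b).zsmul _)
      (𝔓.hullDer_comm n (τ.map_mem _ _ ha) (τ.map_mem _ _ hb)))
  derAct_nov {i j a b} x ha hb := by
    obtain ⟨n, h⟩ := x.2
    refine Subtype.ext ((h.der _).unique
      ((((h.der b).nov a).sub (((h.nov a).der b).zsmul _)).add ((h.der b).der a)) ?_)
    rw [τ.map_nov]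
    exact 𝔓.hullDer_nov n (τ.map_mem _ _ ha) (τ.map_mem _ _ hb)
  novAct_nov {i j a b} x ha hb := by
    obtain ⟨n, h⟩ := x.2
    refine Subtype.ext ((h.nov _).unique (((h.nov a).der b).zsmul _) ?_)
    rw [τ.map_nov]
    exact 𝔓.hullNov_nov n (τ.map_mem _ _ ha) (τ.map_mem _ _ hb)
  novAct_comm {i j a b} x ha hb := by
    obtain ⟨n, h⟩ := x.2
    refine Subtype.ext ((((h.nov b).nov a).sub (((h.nov a).nov b).zsmul _)).unique
      ((h.nov _).sub ((h.nov _).zsmul _)) ?_)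
    rw [τ.map_nov, τ.map_nov]
    exact 𝔓.hullNov_comm n (τ.map_mem _ _ ha) (τ.map_mem _ _ hb)
  derAct_lie {i j a b} x ha hb := by
    obtain ⟨n, h⟩ := x.2
    refine Subtype.ext ((h.der _).unique (((((h.der b).lie a).sub (((h.lie a).der b).zsmul _)).add
      ((h.lie b).der a)).sub (((h.der a).lie b).zsmul _)) ?_)
    rw [τ.map_lie]
    exact 𝔓.hullDer_lie n (τ.map_mem _ _ ha) (τ.map_mem _ _ hb)
  novAct_lie {i j a b} x ha hb := by
    obtain ⟨n, h⟩ := x.2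
    refine Subtype.ext (((h.nov _).add (h.lie _)).unique
      ((((h.lie b).nov a).sub (((h.nov a).lie b).zsmul _)).add (((h.lie a).der b).zsmul _)) ?_)
    rw [τ.map_lie, τ.map_nov]
    exact 𝔓.hullNov_lie n (τ.map_mem _ _ ha) (τ.map_mem _ _ hb)

theorem rep_isFaithful : τ.rep.conformalRep.IsFaithful := by
  -- The pair `(0, id)` is represented by `e` itself, that is, by `(0, 1, 0)`. Its first component
  -- is killed by `{a, ·}` and `d(a) ·`, while `a d(·)` sends it to `id a = a`.
  refine τ.rep.conformalRep_isFaithful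
    ⟨(0, LinearMap.id), (0, 1, 0), by simp, by simp⟩ (LinearMap.fst 𝕜 _ _ ∘ₗ τ.hull.subtype)
    (fun a => ?_) (fun a => ?_) (fun a => ?_)
  · exact (congrArg Prod.fst (G.endLie_apply a _)).trans (map_zero _)
  · exact (congrArg Prod.fst (G.endDer_apply a _)).trans (map_zero _)
  · exact (congrArg Prod.fst (G.endNov_apply a _)).trans (by simp)

end PoissonEmbedding

end GDSuperalgebra

theorem mainTheorem1 {𝕜 : Type u} [Field 𝕜] {V : Type v} [AddCommGroup V] [Module 𝕜 V]
    [FiniteDimensional 𝕜 V] (G : GDSuperalgebra 𝕜 V)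
    (hG : GDSuperalgebra.IsSpecial.{w} G) :
    LieConformalSuperalgebra.HasFFR.{max u v} G.quadratic := by
  obtain ⟨P, _, _, 𝔓, τ, hτ, hmem, hnov, hlie⟩ := hG
  let τ' : G.PoissonEmbedding 𝔓 := ⟨τ, hτ, hmem, hnov, hlie⟩
  exact τ'.rep.hasFFR τ'.rep_isFaithful
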